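/- Let $E=(E^0,E^1,r,s)$ be a row-finite directed graph (each vertex emits at most finitely many edges), let $k$ be a field, and let $L(E)=L_k(E)$ be the Leavitt path algebra: the (possibly non-unital) associative $k$-algebra generated by $v\in E^0$, $e$ and $e^*$ ($e\in E^1$) with relations $vw=\delta_{v,w}v$, $s(e)e=e=e\,r(e)$, $r(e)e^*=e^*=e^*s(e)$, $e^*f=\delta_{e,f}r(e)$, and $v=\sum_{s(e)=v}ee^*$ for every $v$ that is not a sink. It is $\mathbb Z$-graded by $\deg v=0$, $\deg e=1$, $\deg e^*=-1$. Let $\mathcal V^{\mathrm{gr}}(L(E))$ be the commutative monoid of classes of degree-zero idempotent matrices over $L(E)$, formed with respect to integer shifts of the index set (i.e. of graded finitely generated projective modules), where $p\sim q$ if $p=xy$, $q=yx$ for degree-zero matrices $x,y$, addition is the direct sum, and $\mathbb Z$ acts by shifting the degrees. A $\mathbb Z$-order ideal of this monoid is a submonoid $N$ that is stable under $\mathbb Z$ and such that $a+c\in N$ implies $a\in N$; it is $\mathbb Z$-prime if $N_1\cap N_2\subseteq N$ implies $N_1\subseteq N$ or $N_2\subseteq N$ for all $\mathbb Z$-order ideals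 $N_1,N_2$. A graded two-sided ideal $P$ of $L(E)$ is called graded prime if $IJ\subseteq P$ implies $I\subseteq P$ or $J\subseteq P$ for all graded two-sided ideals $I,J$. (In both notions the improper case $N=\mathcal V^{\mathrm{gr}}(L(E))$, respectively $P=L(E)$, is allowed.) A set $H\subseteq E^0$ is hereditary if $s(e)\in H$ implies $r(e)\in H$, and saturated if every $v$ that is not a sink and satisfies $r(e)\in H$ for all $e$ with $s(e)=v$ lies in $H$. Then there are lattice isomorphisms (for the order by inclusion) $$\mathscr L^{\mathrm{gr}}(L(E))\;\xleftarrow{\ \Psi\ }\;\mathscr T_E\;\xrightarrow{\ \Phi\ }\;\mathscr L\big(\mathcal V^{\mathrm{gr}}(L(E))\big)$$ between the lattices of graded two-sided ideals of $L(E)$, of hereditary saturated subsets of $E^0$, and of $\mathbb Z$-order ideals of $\mathcal V^{\mathrm{gr}}(L(E))$, where $\Psi(H)$ is the ideal generated by $H$ and $\Phi(H)$ is the smallest $\mathbb Z$-order ideal containing $[(L(E)v)(n)]$ for all $v\in H$, $n\in\mathbb Z$. Moreover $P\mapsto\Phi(\Psi^{-1}(P))$ is a one-to-one correspondence, order-preserving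 in both directions, between the graded prime ideals of $L(E)$ and the $\mathbb Z$-prime order ideals of $\mathcal V^{\mathrm{gr}}(L(E))$; under it $P=L(E)$ if and only if the corresponding order ideal is all of $\mathcal V^{\mathrm{gr}}(L(E))$, so that it also restricts to a correspondence between the proper ones. -/

import Mathlib

universe u v w

/-! ### Directed graphs, hereditary and saturated sets of vertices -/

/-- A directed graph with vertex set `V`, edge set `E`, source map and range map. -/
structure DirGraph (V : Type u) (E : Type v) where
  /-- the source of an edge -/
  src : E → V
  /-- the range of an edge -/
  rng : E → V

namespace DirGraph

/-- A sink is a vertex that emits no edge. -/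
def IsSink {V : Type u} {E : Type v} (G : DirGraph V E) (x : V) : Prop :=
  ∀ e : E, G.src e ≠ x

/-- A graph is row-finite if every vertex emits at most finitely many edges. -/
def IsRowFinite {V : Type u} {E : Type v} (G : DirGraph V E) : Prop :=
  ∀ x : V, {e : E | G.src e = x}.Finite

/-- `H` is hereditary: an edge that starts in `H` ends in `H`. -/
def IsHereditary {V : Type u} {E : Type v} (G : DirGraph V E) (H : Set V) : Prop :=
  ∀ e : E, G.src e ∈ H → G.rng e ∈ H

/-- `H` is saturated: a vertex that is not a sink and all of whose edges end in `H` is in `H`. -/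
def IsSaturated {V : Type u} {E : Type v} (G : DirGraph V E) (H : Set V) : Prop :=
  ∀ x : V, ¬ G.IsSink x → (∀ e : E, G.src e = x → G.rng e ∈ H) → x ∈ H

/-- The hereditary saturated sets of vertices, ordered by inclusion. -/
def HerSat {V : Type u} {E : Type v} (G : DirGraph V E) : Type u :=
  {H : Set V // G.IsHereditary H ∧ G.IsSaturated H}

instance {V : Type u} {E : Type v} (G : DirGraph V E) : PartialOrder G.HerSat :=
  Subtype.partialOrder _

instance {V : Type u} {E : Type v} (G : DirGraph V E) : InfSet G.HerSat where
  sInf S := ⟨{x | ∀ H ∈ S, x ∈ H.1},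
    fun e he H hH => H.2.1 e (he H hH),
    fun x hx h H hH => H.2.2 x hx fun e he => h e he H hH⟩

noncomputable instance {V : Type u} {E : Type v} (G : DirGraph V E) : CompleteLattice G.HerSat :=
  completeLatticeOfInf _ fun _ =>
    ⟨fun H hH _ hx => hx H hH, fun _ hK _ hx _ hH => hK hH hx⟩

end DirGraph

/-! ### Leavitt path algebras -/

/-- The generators of a path algebra: vertices `v`, edges `e` and ghost edges `e*`. -/
inductive PathGen (V : Type u) (E : Type v) : Type (max u v)
  | vertex (x : V) : PathGen V E
  | edge (e : E) : PathGen V E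
  | ghost (e : E) : PathGen V E

/-- The degree of a generator: `0` for a vertex, `1` for an edge, `-1` for a ghost edge. -/
def PathGen.degree {V : Type u} {E : Type v} : PathGen V E → ℤ
  | .vertex _ => 0
  | .edge _ => 1
  | .ghost _ => -1

/-- The free associative (non-unital) `k`-algebra on the generators: its `k`-basis consists of the
nonempty words in the generators. -/
abbrev FreePathAlgebra (k : Type w) [Field k] (V : Type u) (E : Type v) : Type (max u v w) :=
  MonoidAlgebra k (FreeSemigroup (PathGen V E))

/-- The degree of a word is the sum of the degrees of its letters. -/
def wordDegree {V : Type u} {E : Type v} (p : FreeSemigroup (PathGen V E)) : ℤ :=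
  (FreeSemigroup.lift (fun x : PathGen V E => Multiplicative.ofAdd x.degree) p).toAdd

namespace DirGraph

/-- A generator, as an element of the free algebra. -/
noncomputable def gen (k : Type w) [Field k] {V : Type u} {E : Type v} (x : PathGen V E) :
    FreePathAlgebra k V E :=
  MonoidAlgebra.single (FreeSemigroup.of x) 1

/-- The elements of the free algebra that are set to `0` in the Leavitt path algebra. The last
constructor is the relation `x = ∑ e e*`, over the edges `e` with source `x`, for every vertex `x`
that emits a nonzero finite number of edges. -/
inductive Relator (k : Type w) [Field k] {V : Type u} {E : Type v} (G : DirGraph V E) :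
    FreePathAlgebra k V E → Prop
  | vertex_mul_self (x : V) :
      Relator k G (gen k (.vertex x) * gen k (.vertex x) - gen k (.vertex x))
  | vertex_mul_ne (x y : V) (h : x ≠ y) :
      Relator k G (gen k (.vertex x) * gen k (.vertex y))
  | src_mul_edge (e : E) :
      Relator k G (gen k (.vertex (G.src e)) * gen k (.edge e) - gen k (.edge e))
  | edge_mul_rng (e : E) :
      Relator k G (gen k (.edge e) * gen k (.vertex (G.rng e)) - gen k (.edge e))
  | rng_mul_ghost (e : E) :
      Relator k G (gen k (.vertex (G.rng e)) * gen k (.ghost e) - gen k (.ghost e))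
  | ghost_mul_src (e : E) :
      Relator k G (gen k (.ghost e) * gen k (.vertex (G.src e)) - gen k (.ghost e))
  | ghost_mul_edge_self (e : E) :
      Relator k G (gen k (.ghost e) * gen k (.edge e) - gen k (.vertex (G.rng e)))
  | ghost_mul_edge_ne (e f : E) (h : e ≠ f) :
      Relator k G (gen k (.ghost e) * gen k (.edge f))
  | vertex_eq_sum (x : V) (hx : ¬ G.IsSink x) (hfin : {e : E | G.src e = x}.Finite) :
      Relator k G (gen k (.vertex x) - ∑ e ∈ hfin.toFinset, gen k (.edge e) * gen k (.ghost e))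

/-- The ideal of the free algebra that is generated by the relators; all scalar multiples of the
relators are among the generators, so that it is the ideal they generate as an ideal of a
`k`-algebra, although the free algebra has no unit. -/
noncomputable def relatorIdeal (k : Type w) [Field k] {V : Type u} {E : Type v}
    (G : DirGraph V E) : TwoSidedIdeal (FreePathAlgebra k V E) :=
  TwoSidedIdeal.span {y | ∃ (c : k) (x : FreePathAlgebra k V E), Relator k G x ∧ y = c • x}

/-- The Leavitt path algebra `L_k(G)`. -/
def Leavitt (k : Type w) [Field k] {V : Type u} {E : Type v} (G : DirGraph V E) :
    Type (max u v w) :=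
  (relatorIdeal k G).ringCon.Quotient

noncomputable instance (k : Type w) [Field k] {V : Type u} {E : Type v} (G : DirGraph V E) :
    NonUnitalRing (Leavitt k G) :=
  inferInstanceAs (NonUnitalRing (relatorIdeal k G).ringCon.Quotient)

/-- The quotient map from the free algebra onto the Leavitt path algebra. -/
noncomputable def toLeavitt (k : Type w) [Field k] {V : Type u} {E : Type v} (G : DirGraph V E) :
    FreePathAlgebra k V E →ₙ+* Leavitt k G where
  toFun x := ((x : (relatorIdeal k G).ringCon.Quotient))
  map_mul' _ _ := rfl
  map_zero' := rfl
  map_add' _ _ := rfl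

/-- A vertex, as an element of the Leavitt path algebra. -/
noncomputable def leavittVertex (k : Type w) [Field k] {V : Type u} {E : Type v}
    (G : DirGraph V E) (x : V) : Leavitt k G :=
  toLeavitt k G (gen k (.vertex x))

/-- The homogeneous component of degree `n` of the Leavitt path algebra: the span of the images of
all words of degree `n`. -/
noncomputable def leavittGrading (k : Type w) [Field k] {V : Type u} {E : Type v}
    (G : DirGraph V E) (n : ℤ) : AddSubgroup (Leavitt k G) :=
  AddSubgroup.closure {a | ∃ (p : FreeSemigroup (PathGen V E)) (c : k),
    wordDegree p = n ∧ a = toLeavitt k G (MonoidAlgebra.single p c)}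

instance (k : Type w) [Field k] {V : Type u} {E : Type v} (G : DirGraph V E) :
    SetLike.GradedMul (leavittGrading k G) where
  mul_mem {i j a b} ha hb := by
    refine AddSubgroup.closure_induction
      (p := fun a _ => a * b ∈ leavittGrading k G (i + j)) ?_ ?_ ?_ ?_ ha
    · rintro _ ⟨p, c, hp, rfl⟩
      refine AddSubgroup.closure_induction
        (p := fun b _ => toLeavitt k G (MonoidAlgebra.single p c) * b ∈
          leavittGrading k G (i + j)) ?_ ?_ ?_ ?_ hb
      · rintro _ ⟨q, d, hq, rfl⟩
        refine AddSubgroup.subset_closure ⟨p * q, c * d, ?_, ?_⟩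
        · simp only [wordDegree, map_mul, toAdd_mul] at hp hq ⊢
          rw [hp, hq]
        · rw [← map_mul, MonoidAlgebra.single_mul_single]
      · rw [mul_zero]
        exact zero_mem _
      · intro y z _ _ h1 h2
        rw [mul_add]
        exact add_mem h1 h2
      · intro y _ h
        rw [mul_neg]
        exact neg_mem h
    · rw [zero_mul]
      exact zero_mem _
    · intro y z _ _ h1 h2
      rw [add_mul]
      exact add_mem h1 h2
    · intro y _ h
      rw [neg_mul]
      exact neg_mem h

theorem leavittVertex_mem (k : Type w) [Field k] {V : Type u} {E : Type v} (G : DirGraph V E)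
    (x : V) : leavittVertex k G x ∈ leavittGrading k G 0 :=
  AddSubgroup.subset_closure ⟨FreeSemigroup.of (.vertex x), 1, by
    simp [wordDegree, PathGen.degree], rfl⟩

theorem leavittVertex_mul_self (k : Type w) [Field k] {V : Type u} {E : Type v}
    (G : DirGraph V E) (x : V) :
    leavittVertex k G x * leavittVertex k G x = leavittVertex k G x := by
  have h : gen k (.vertex x) * gen k (.vertex x) - gen k (.vertex x) ∈ relatorIdeal k G :=
    TwoSidedIdeal.subset_span ⟨1, _, Relator.vertex_mul_self x, (one_smul k _).symm⟩
  exact (RingCon.eq _).2 ((TwoSidedIdeal.rel_iff _ _ _).2 h)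

end DirGraph

/-! ### Graded ideals and graded prime ideals -/

/-- The graded two-sided ideals of a `ℤ`-graded ring `A` (possibly without unit), ordered by
inclusion: every element of the ideal is a sum of homogeneous elements of the ideal. -/
def GradedIdeal {A : Type u} [NonUnitalRing A] (𝒜 : ℤ → AddSubgroup A) : Type u :=
  {I : TwoSidedIdeal A //
    ∀ a ∈ I, a ∈ AddSubgroup.closure {b : A | b ∈ I ∧ ∃ n : ℤ, b ∈ 𝒜 n}}

namespace GradedIdeal

instance {A : Type u} [NonUnitalRing A] (𝒜 : ℤ → AddSubgroup A) : PartialOrder (GradedIdeal 𝒜) :=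
  Subtype.partialOrder _

theorem closure_sSup {A : Type u} [NonUnitalRing A] (𝒜 : ℤ → AddSubgroup A)
    (S : Set (GradedIdeal 𝒜)) :
    ∀ a ∈ sSup (Subtype.val '' S : Set (TwoSidedIdeal A)), a ∈ AddSubgroup.closure
      {b : A | b ∈ sSup (Subtype.val '' S : Set (TwoSidedIdeal A)) ∧ ∃ n : ℤ, b ∈ 𝒜 n} := by
  set J : TwoSidedIdeal A := sSup (Subtype.val '' S : Set (TwoSidedIdeal A)) with hJ
  set U : Set A := {b : A | ∃ I ∈ S, b ∈ I.1} with hU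
  have hUJ : ∀ I ∈ S, ∀ b : A, b ∈ I.1 → b ∈ J := fun I hI b hb =>
    (le_sSup (Set.mem_image_of_mem _ hI) : I.1 ≤ J) hb
  have hUc : ∀ b ∈ U, b ∈ AddSubgroup.closure {b : A | b ∈ J ∧ ∃ n : ℤ, b ∈ 𝒜 n} := by
    rintro b ⟨I, hI, hb⟩
    have hle : {b : A | b ∈ I.1 ∧ ∃ n : ℤ, b ∈ 𝒜 n} ⊆ {b : A | b ∈ J ∧ ∃ n : ℤ, b ∈ 𝒜 n} :=
      fun c hc => ⟨hUJ I hI c hc.1, hc.2⟩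
    exact AddSubgroup.closure_mono hle (I.2 b hb)
  intro a ha
  let T : TwoSidedIdeal A := TwoSidedIdeal.mk' (AddSubgroup.closure U : Set A)
    (zero_mem _) (fun h1 h2 => add_mem h1 h2) (fun h => neg_mem h)
    (by
      intro x y hy
      refine AddSubgroup.closure_induction (p := fun y _ => x * y ∈ AddSubgroup.closure U)
        ?_ ?_ ?_ ?_ hy
      · rintro y ⟨I, hI, hyI⟩
        exact AddSubgroup.subset_closure ⟨I, hI, I.1.mul_mem_left _ _ hyI⟩
      · rw [mul_zero]
        exact zero_mem _
      · intro y z _ _ h1 h2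
        rw [mul_add]
        exact add_mem h1 h2
      · intro y _ h
        rw [mul_neg]
        exact neg_mem h)
    (by
      intro x y hx
      refine AddSubgroup.closure_induction (p := fun x _ => x * y ∈ AddSubgroup.closure U)
        ?_ ?_ ?_ ?_ hx
      · rintro x ⟨I, hI, hxI⟩
        exact AddSubgroup.subset_closure ⟨I, hI, I.1.mul_mem_right _ _ hxI⟩
      · rw [zero_mul]
        exact zero_mem _
      · intro x z _ _ h1 h2
        rw [add_mul]
        exact add_mem h1 h2
      · intro x _ h
        rw [neg_mul]
        exact neg_mem h)
  have hT : J ≤ T := by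
    refine sSup_le ?_
    rintro _ ⟨I, hI, rfl⟩ b hb
    exact (TwoSidedIdeal.mem_mk' _ _ _ _ _ _ _).2 (AddSubgroup.subset_closure ⟨I, hI, hb⟩)
  have haT : a ∈ AddSubgroup.closure U := (TwoSidedIdeal.mem_mk' _ _ _ _ _ _ _).1 (hT ha)
  exact (AddSubgroup.closure_le _).2 hUc haT

/-- Joins of graded ideals are sums of ideals. -/
instance {A : Type u} [NonUnitalRing A] (𝒜 : ℤ → AddSubgroup A) : SupSet (GradedIdeal 𝒜) where
  sSup S := ⟨sSup (Subtype.val '' S), closure_sSup 𝒜 S⟩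

noncomputable instance {A : Type u} [NonUnitalRing A] (𝒜 : ℤ → AddSubgroup A) :
    CompleteLattice (GradedIdeal 𝒜) :=
  completeLatticeOfSup _ fun S =>
    ⟨fun I hI => (le_sSup (Set.mem_image_of_mem _ hI) :
        I.1 ≤ sSup (Subtype.val '' S : Set (TwoSidedIdeal A))),
      fun K hK => (sSup_le (by rintro _ ⟨I, hI, rfl⟩; exact hK hI) :
        sSup (Subtype.val '' S : Set (TwoSidedIdeal A)) ≤ K.1)⟩

/-- A graded ideal `P` is graded prime if `I J ⊆ P` implies `I ⊆ P` or `J ⊆ P`, for all graded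
ideals `I` and `J`. The ring itself is not excluded. -/
def IsGradedPrime {A : Type u} [NonUnitalRing A] {𝒜 : ℤ → AddSubgroup A} (P : GradedIdeal 𝒜) :
    Prop :=
  ∀ I J : GradedIdeal 𝒜, (∀ a ∈ I.1, ∀ b ∈ J.1, a * b ∈ P.1) → I ≤ P ∨ J ≤ P

end GradedIdeal

/-! ### Order ideals of a commutative monoid with a group action -/

/-- A `Γ`-order ideal of a commutative monoid `M` on which the group `Γ` acts by automorphisms:
a submonoid that is stable under `Γ` and hereditary for the preorder in which `a ≤ b` means
`b = a + c` for some `c`. -/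
structure OrderIdeal (Γ : Type v) (M : Type u) [Group Γ] [AddCommMonoid M]
    [DistribMulAction Γ M] extends AddSubmonoid M where
  smul_mem' : ∀ (g : Γ) (a : M), a ∈ carrier → g • a ∈ carrier
  hereditary' : ∀ a b : M, (∃ c, b = a + c) → b ∈ carrier → a ∈ carrier

namespace OrderIdeal

instance (Γ : Type v) (M : Type u) [Group Γ] [AddCommMonoid M] [DistribMulAction Γ M] :
    SetLike (OrderIdeal Γ M) M where
  coe N := N.carrier
  coe_injective := by
    rintro ⟨N, _, _⟩ ⟨N', _, _⟩ h
    obtain rfl : N = N' := SetLike.coe_injective h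
    rfl

instance (Γ : Type v) (M : Type u) [Group Γ] [AddCommMonoid M] [DistribMulAction Γ M] :
    PartialOrder (OrderIdeal Γ M) :=
  PartialOrder.ofSetLike _ _

instance (Γ : Type v) (M : Type u) [Group Γ] [AddCommMonoid M] [DistribMulAction Γ M] :
    InfSet (OrderIdeal Γ M) where
  sInf S :=
    { carrier := {a | ∀ N ∈ S, a ∈ N}
      add_mem' := fun ha hb N hN => N.add_mem' (ha N hN) (hb N hN)
      zero_mem' := fun N _ => N.zero_mem'
      smul_mem' := fun g a ha N hN => N.smul_mem' g a (ha N hN)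
      hereditary' := fun a b h hb N hN => N.hereditary' a b h (hb N hN) }

noncomputable instance (Γ : Type v) (M : Type u) [Group Γ] [AddCommMonoid M]
    [DistribMulAction Γ M] : CompleteLattice (OrderIdeal Γ M) :=
  completeLatticeOfInf _ fun _ =>
    ⟨fun N hN _ ha => ha N hN, fun _ hK _ ha _ hN => hK hN ha⟩

/-- A `Γ`-order ideal `N` is `Γ`-prime if `N₁ ∩ N₂ ⊆ N` implies `N₁ ⊆ N` or `N₂ ⊆ N`, for all
`Γ`-order ideals `N₁` and `N₂`. The monoid itself is not excluded. -/
def IsPrime {Γ : Type v} {M : Type u} [Group Γ] [AddCommMonoid M] [DistribMulAction Γ M]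
    (N : OrderIdeal Γ M) : Prop :=
  ∀ N₁ N₂ : OrderIdeal Γ M, (N₁ : Set M) ∩ (N₂ : Set M) ⊆ (N : Set M) →
    (N₁ : Set M) ⊆ (N : Set M) ∨ (N₂ : Set M) ⊆ (N : Set M)

end OrderIdeal

/-! ### The monoid `V^gr` of a graded ring, possibly without unit -/

/-- An idempotent square matrix `p` over a `ℤ`-graded ring `A`, of degree `0` with respect to the
shifts `d i`: it represents the graded left module `(⨁ i, A(d i)) p`, where the elements of
`⨁ i, A(d i)` are row vectors and `A(d)_n = A_{n + d}`. -/
structure GradedIdempotent {A : Type u} [NonUnitalRing A] (𝒜 : ℤ → AddSubgroup A) where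
  /-- the finite index set of rows and columns -/
  ι : Type
  [fin : Fintype ι]
  /-- the shifts -/
  d : ι → ℤ
  /-- the matrix -/
  p : Matrix ι ι A
  mem : ∀ i j, p i j ∈ 𝒜 (d j - d i)
  idem : p * p = p

attribute [instance] GradedIdempotent.fin

namespace GradedIdempotent

/-- Two idempotents `p` and `q` are equivalent if `p = x y` and `q = y x` for (rectangular)
matrices `x` and `y` of degree `0`; that is, if they represent isomorphic graded modules. -/
def Equivalent {A : Type u} [NonUnitalRing A] {𝒜 : ℤ → AddSubgroup A}
    (P Q : GradedIdempotent 𝒜) : Prop :=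
  ∃ (x : Matrix P.ι Q.ι A) (y : Matrix Q.ι P.ι A),
    (∀ i j, x i j ∈ 𝒜 (Q.d j - P.d i)) ∧ (∀ j i, y j i ∈ 𝒜 (P.d i - Q.d j)) ∧
      x * y = P.p ∧ y * x = Q.p

theorem mul_mem_degree {A : Type u} [NonUnitalRing A] {𝒜 : ℤ → AddSubgroup A}
    [SetLike.GradedMul 𝒜] {l m n : Type} [Fintype m] {a : l → ℤ} {b : m → ℤ} {c : n → ℤ}
    {x : Matrix l m A} {y : Matrix m n A} (hx : ∀ i j, x i j ∈ 𝒜 (b j - a i))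
    (hy : ∀ i j, y i j ∈ 𝒜 (c j - b i)) (i : l) (j : n) : (x * y) i j ∈ 𝒜 (c j - a i) := by
  rw [Matrix.mul_apply]
  refine sum_mem fun t _ => ?_
  have h := SetLike.mul_mem_graded (hx i t) (hy t j)
  rwa [show b t - a i + (c j - b t) = c j - a i by ring] at h

instance setoid {A : Type u} [NonUnitalRing A] (𝒜 : ℤ → AddSubgroup A) [SetLike.GradedMul 𝒜] :
    Setoid (GradedIdempotent 𝒜) where
  r := Equivalent
  iseqv :=
    { refl := fun P => ⟨P.p, P.p, P.mem, P.mem, P.idem, P.idem⟩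
      symm := by
        rintro P Q ⟨x, y, hx, hy, h1, h2⟩
        exact ⟨y, x, hy, hx, h2, h1⟩
      trans := by
        rintro P Q R ⟨x, y, hx, hy, h1, h2⟩ ⟨z, w, hz, hw, h3, h4⟩
        refine ⟨x * z, w * y, mul_mem_degree hx hz, mul_mem_degree hw hy, ?_, ?_⟩
        · calc x * z * (w * y) = x * (z * w) * y := by simp only [Matrix.mul_assoc]
            _ = (x * y) * (x * y) := by rw [h3, ← h2]; simp only [Matrix.mul_assoc]
            _ = P.p := by rw [h1, P.idem]
        · calc w * y * (x * z) = w * (y * x) * z := by simp only [Matrix.mul_assoc]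
            _ = (w * z) * (w * z) := by rw [h2, ← h3]; simp only [Matrix.mul_assoc]
            _ = R.p := by rw [h4, R.idem] }

/-- The direct sum of two idempotents is the block diagonal matrix. -/
def directSum {A : Type u} [NonUnitalRing A] {𝒜 : ℤ → AddSubgroup A}
    (P Q : GradedIdempotent 𝒜) : GradedIdempotent 𝒜 where
  ι := P.ι ⊕ Q.ι
  d := Sum.elim P.d Q.d
  p := Matrix.fromBlocks P.p 0 0 Q.p
  mem := by
    rintro (i | i) (j | j)
    · exact P.mem i j
    · exact zero_mem _
    · exact zero_mem _
    · exact Q.mem i j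
  idem := by simp [Matrix.fromBlocks_multiply, P.idem, Q.idem]

/-- The zero idempotent. -/
def zero {A : Type u} [NonUnitalRing A] (𝒜 : ℤ → AddSubgroup A) : GradedIdempotent 𝒜 where
  ι := Empty
  d := Empty.elim
  p := 0
  mem := fun i => i.elim
  idem := by simp

/-- The shift of an idempotent by `n`, which represents the shifted module `M(n)`. -/
def shift {A : Type u} [NonUnitalRing A] {𝒜 : ℤ → AddSubgroup A} (n : ℤ)
    (P : GradedIdempotent 𝒜) : GradedIdempotent 𝒜 where
  ι := P.ι
  d i := P.d i + n
  p := P.p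
  mem i j := by
    rw [add_sub_add_right_eq_sub]
    exact P.mem i j
  idem := P.idem

/-- An idempotent `e` of degree `0` and a shift `n`, as a `1 × 1` matrix, which represents the
shifted module `(A e)(n)`. -/
def single {A : Type u} [NonUnitalRing A] {𝒜 : ℤ → AddSubgroup A} (e : A) (he : e ∈ 𝒜 0)
    (hee : e * e = e) (n : ℤ) : GradedIdempotent 𝒜 where
  ι := Unit
  d _ := n
  p := Matrix.of fun _ _ => e
  mem _ _ := by
    rw [sub_self]
    exact he
  idem := by
    ext i j
    rw [Matrix.mul_apply]
    simp [hee]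

/-- Idempotents that differ by a bijection of the index sets are equivalent. -/
theorem equivalent_of_equiv {A : Type u} [NonUnitalRing A] {𝒜 : ℤ → AddSubgroup A}
    (P Q : GradedIdempotent 𝒜) (f : P.ι ≃ Q.ι) (hd : ∀ i, Q.d (f i) = P.d i)
    (hp : ∀ i j, Q.p (f i) (f j) = P.p i j) : Equivalent P Q := by
  have hQ : Q.p.submatrix f f = P.p := by
    ext i j
    exact hp i j
  refine ⟨Q.p.submatrix f id, Q.p.submatrix id f, fun i j => ?_, fun j i => ?_, ?_, ?_⟩
  · rw [← hd]
    exact Q.mem _ _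
  · rw [← hd]
    exact Q.mem _ _
  · rw [← Matrix.submatrix_mul _ _ f id f Function.bijective_id, Q.idem, hQ]
  · rw [← Matrix.submatrix_mul _ _ id f id f.bijective, Q.idem, Matrix.submatrix_id_id]

theorem Equivalent.directSum {A : Type u} [NonUnitalRing A] {𝒜 : ℤ → AddSubgroup A}
    {P P' Q Q' : GradedIdempotent 𝒜} (h : Equivalent P P') (h' : Equivalent Q Q') :
    Equivalent (P.directSum Q) (P'.directSum Q') := by
  obtain ⟨x, y, hx, hy, h1, h2⟩ := h
  obtain ⟨z, w, hz, hw, h3, h4⟩ := h'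
  refine ⟨Matrix.fromBlocks x 0 0 z, Matrix.fromBlocks y 0 0 w, ?_, ?_, ?_, ?_⟩
  · rintro (i | i) (j | j)
    · exact hx i j
    · exact zero_mem _
    · exact zero_mem _
    · exact hz i j
  · rintro (i | i) (j | j)
    · exact hy i j
    · exact zero_mem _
    · exact zero_mem _
    · exact hw i j
  · exact (Matrix.fromBlocks_multiply _ _ _ _ _ _ _ _).trans (by simp [h1, h3, GradedIdempotent.directSum])
  · exact (Matrix.fromBlocks_multiply _ _ _ _ _ _ _ _).trans (by simp [h2, h4, GradedIdempotent.directSum])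

theorem Equivalent.shift {A : Type u} [NonUnitalRing A] {𝒜 : ℤ → AddSubgroup A}
    {P Q : GradedIdempotent 𝒜} (n : ℤ) (h : Equivalent P Q) :
    Equivalent (P.shift n) (Q.shift n) := by
  obtain ⟨x, y, hx, hy, h1, h2⟩ := h
  refine ⟨x, y, fun i j => ?_, fun j i => ?_, h1, h2⟩
  · simpa [GradedIdempotent.shift] using hx i j
  · simpa [GradedIdempotent.shift] using hy j i

end GradedIdempotent

/-- The monoid `V^gr(A)` of a `ℤ`-graded ring `A`, possibly without unit: the equivalence classes
of degree-zero idempotent matrices over `A`. -/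
def Vgr {A : Type u} [NonUnitalRing A] (𝒜 : ℤ → AddSubgroup A) [SetLike.GradedMul 𝒜] :
    Type (max 1 u) :=
  Quotient (GradedIdempotent.setoid 𝒜)

namespace Vgr

open GradedIdempotent

/-- The class of an idempotent matrix. -/
def mk {A : Type u} [NonUnitalRing A] {𝒜 : ℤ → AddSubgroup A} [SetLike.GradedMul 𝒜]
    (P : GradedIdempotent 𝒜) : Vgr 𝒜 :=
  Quotient.mk (GradedIdempotent.setoid 𝒜) P

instance {A : Type u} [NonUnitalRing A] (𝒜 : ℤ → AddSubgroup A) [SetLike.GradedMul 𝒜] :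
    Zero (Vgr 𝒜) :=
  ⟨mk (zero 𝒜)⟩

instance {A : Type u} [NonUnitalRing A] (𝒜 : ℤ → AddSubgroup A) [SetLike.GradedMul 𝒜] :
    Add (Vgr 𝒜) :=
  ⟨Quotient.map₂ directSum fun _ _ h _ _ h' => Equivalent.directSum h h'⟩

/-- Addition is induced by the direct sum. -/
instance {A : Type u} [NonUnitalRing A] (𝒜 : ℤ → AddSubgroup A) [SetLike.GradedMul 𝒜] :
    AddCommMonoid (Vgr 𝒜) where
  add_assoc := by
    rintro ⟨P⟩ ⟨Q⟩ ⟨R⟩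
    refine Quotient.sound (equivalent_of_equiv _ _ (Equiv.sumAssoc P.ι Q.ι R.ι) ?_ ?_)
    · rintro ((i | i) | i) <;> rfl
    · rintro ((i | i) | i) ((j | j) | j) <;> rfl
  zero_add := by
    rintro ⟨P⟩
    refine Quotient.sound (equivalent_of_equiv _ _ (Equiv.emptySum Empty P.ι) ?_ ?_)
    · rintro (i | i)
      · exact i.elim
      · rfl
    · rintro (i | i) (j | j)
      · exact i.elim
      · exact i.elim
      · exact j.elim
      · rfl
  add_zero := by
    rintro ⟨P⟩
    refine Quotient.sound (equivalent_of_equiv _ _ (Equiv.sumEmpty P.ι Empty) ?_ ?_)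
    · rintro (i | i)
      · rfl
      · exact i.elim
    · rintro (i | i) (j | j)
      · rfl
      · exact j.elim
      · exact i.elim
      · exact i.elim
  add_comm := by
    rintro ⟨P⟩ ⟨Q⟩
    refine Quotient.sound (equivalent_of_equiv _ _ (Equiv.sumComm P.ι Q.ι) ?_ ?_)
    · rintro (i | i) <;> rfl
    · rintro (i | i) (j | j) <;> rfl
  nsmul := nsmulRec

instance {A : Type u} [NonUnitalRing A] (𝒜 : ℤ → AddSubgroup A) [SetLike.GradedMul 𝒜] :
    SMul (Multiplicative ℤ) (Vgr 𝒜) :=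
  ⟨fun g => Quotient.map (shift g.toAdd) fun _ _ h => Equivalent.shift _ h⟩

/-- The group `ℤ` (written multiplicatively) acts on `V^gr(A)` by shifts. -/
instance {A : Type u} [NonUnitalRing A] (𝒜 : ℤ → AddSubgroup A) [SetLike.GradedMul 𝒜] :
    DistribMulAction (Multiplicative ℤ) (Vgr 𝒜) where
  one_smul := by
    rintro ⟨P⟩
    refine Quotient.sound (equivalent_of_equiv _ _ (Equiv.refl P.ι) ?_ fun _ _ => rfl)
    exact fun i => (add_zero (P.d i)).symm
  mul_smul := by
    rintro g h ⟨P⟩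
    refine Quotient.sound (equivalent_of_equiv _ _ (Equiv.refl P.ι) ?_ fun _ _ => rfl)
    exact fun i => (add_assoc (P.d i) h.toAdd g.toAdd).trans
      (congrArg (P.d i + ·) (add_comm h.toAdd g.toAdd))
  smul_zero := by
    intro g
    exact Quotient.sound (equivalent_of_equiv _ _ (Equiv.refl Empty) (fun i => i.elim)
      fun i => i.elim)
  smul_add := by
    rintro g ⟨P⟩ ⟨Q⟩
    refine Quotient.sound (equivalent_of_equiv _ _ (Equiv.refl (P.ι ⊕ Q.ι)) ?_ ?_)
    · rintro (i | i) <;> rfl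
    · rintro (i | i) (j | j) <;> rfl

end Vgr

namespace DirGraph

/-- The class `[(L(G) x)(n)]` in `V^gr(L(G))`, for a vertex `x` and a shift `n`. -/
noncomputable def vertexClass (k : Type w) [Field k] {V : Type u} {E : Type v}
    (G : DirGraph V E) (x : V) (n : ℤ) : Vgr (leavittGrading k G) :=
  Vgr.mk (GradedIdempotent.single (leavittVertex k G x) (leavittVertex_mem k G x)
    (leavittVertex_mul_self k G x) n)

end DirGraph

/-! Both kinds of ideals are determined by vertices: a graded ideal `I` by the `v` with `v ∈ I`, an
order ideal `N` by the `v` with `[L(E)v] ∈ N`. Two facts carry the proof.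

Reduction (`mem_reductions`): every homogeneous `a` is a sum of terms `x u y` of its degree, where
`u` is a vertex with `u = x' a y'` and `x'`, `y'` have the degrees opposite to `x`, `y`. To see
this, write `a` as a sum of terms `α β*`. Multiplying by `e*` on the left strips `α`, multiplying by
`e` on the right strips `β*`, and `v = ∑ e e*` restores what was stripped; at a sink the terms that
would need this relation vanish. What is left is a linear combination of vertices, and nonzero
coefficients are invertible. Hence a graded ideal is generated by its vertices. Applied to the
entries of an idempotent `p`, reduction says that `[p] ∈ N` exactly when these entries lie in the
ideal generated by the vertices of `N`: factorizations of the right degrees exhibit direct summands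
of shifted modules (`mk_mem_of_entries`).

Separation (`mem_of_vertex_mem_span`): the ideal generated by a hereditary saturated `H` contains no
vertex outside `H`, because `L(E)` acts on the functions on `V × ℕ` in such a way that exactly the
vertices in `H` act as zero.

Both notions of prime then become the same condition `HerSat.IsPrime` on `H`. For ideals, a product
lies in both of its ideals, so reduction puts it in the ideal of any hereditary saturated set that
contains the common vertices; conversely a common vertex is the product of itself with itself. -/

namespace DirGraph

/-! ### Relations in the Leavitt path algebra -/

variable (k : Type w) [Field k] {V : Type u} {E : Type v} (G : DirGraph V E)

/-- An edge, as an element of the Leavitt path algebra. -/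
noncomputable def leavittEdge (e : E) : Leavitt k G := toLeavitt k G (gen k (.edge e))

/-- A ghost edge, as an element of the Leavitt path algebra. -/
noncomputable def leavittGhost (e : E) : Leavitt k G := toLeavitt k G (gen k (.ghost e))

/-- A scalar multiple of a vertex, as an element of the Leavitt path algebra. -/
noncomputable def scaledVertex (c : k) (x : V) : Leavitt k G :=
  toLeavitt k G (MonoidAlgebra.single (FreeSemigroup.of (.vertex x)) c)

variable {k}

/-- `Leavitt k G` is used only as a ring, so scalars must act inside the free algebra; this is where
it matters that the relator ideal contains all scalar multiples of the relators. -/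
theorem toLeavitt_smul_eq_zero {y : FreePathAlgebra k V E} (h : Relator k G y) (c : k) :
    toLeavitt k G (c • y) = 0 := by
  have h : c • y ∈ relatorIdeal k G := TwoSidedIdeal.subset_span ⟨c, _, h, rfl⟩
  refine (RingCon.eq _).2 ((TwoSidedIdeal.rel_iff _ _ _).2 ?_)
  simpa using h

theorem toLeavitt_eq_zero {y : FreePathAlgebra k V E} (h : Relator k G y) :
    toLeavitt k G y = 0 := by
  simpa using toLeavitt_smul_eq_zero G h 1

theorem toLeavitt_smul_eq {y z : FreePathAlgebra k V E} (h : Relator k G (y - z)) (c : k) :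
    toLeavitt k G (c • y) = toLeavitt k G (c • z) := by
  have := toLeavitt_smul_eq_zero G h c
  rwa [smul_sub, map_sub, sub_eq_zero] at this

theorem smul_gen_mul_gen (c : k) (x y : PathGen V E) :
    c • (gen k x * gen k y) = MonoidAlgebra.single (FreeSemigroup.of x) c * gen k y := by
  simp [gen, MonoidAlgebra.single_mul_single]

theorem smul_gen_mul_gen' (c : k) (x y : PathGen V E) :
    c • (gen k x * gen k y) = gen k x * MonoidAlgebra.single (FreeSemigroup.of y) c := by
  simp [gen, MonoidAlgebra.single_mul_single]

theorem smul_gen (c : k) (x : PathGen V E) :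
    c • gen k x = MonoidAlgebra.single (FreeSemigroup.of x) c := by
  simp [gen]

theorem scaledVertex_one (x : V) : scaledVertex k G 1 x = leavittVertex k G x := rfl

theorem scaledVertex_zero (x : V) : scaledVertex k G 0 x = 0 := by
  simp [scaledVertex]

theorem scaledVertex_add (c d : k) (x : V) :
    scaledVertex k G (c + d) x = scaledVertex k G c x + scaledVertex k G d x := by
  simp [scaledVertex, MonoidAlgebra.single_add]

theorem scaledVertex_neg (c : k) (x : V) :
    scaledVertex k G (-c) x = -scaledVertex k G c x := by
  rw [eq_neg_iff_add_eq_zero, ← scaledVertex_add, neg_add_cancel, scaledVertex_zero]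

theorem scaledVertex_mul_self (c d : k) (x : V) :
    scaledVertex k G c x * scaledVertex k G d x = scaledVertex k G (c * d) x := by
  have := toLeavitt_smul_eq G (Relator.vertex_mul_self (k := k) (G := G) x) (c * d)
  rw [smul_gen] at this
  rw [scaledVertex, scaledVertex, scaledVertex, ← this, ← map_mul]
  simp [gen, MonoidAlgebra.single_mul_single]

theorem scaledVertex_mul_of_ne (c d : k) {x y : V} (h : x ≠ y) :
    scaledVertex k G c x * scaledVertex k G d y = 0 := by
  have := toLeavitt_smul_eq_zero G (Relator.vertex_mul_ne (k := k) (G := G) x y h) (c * d)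
  rw [scaledVertex, scaledVertex, ← this, ← map_mul]
  simp [gen, MonoidAlgebra.single_mul_single]

theorem vertex_mul_of_ne {x y : V} (h : x ≠ y) :
    leavittVertex k G x * leavittVertex k G y = 0 :=
  scaledVertex_mul_of_ne G 1 1 h

theorem vertex_mul_scaledVertex (c : k) (x : V) :
    leavittVertex k G x * scaledVertex k G c x = scaledVertex k G c x := by
  rw [← scaledVertex_one, scaledVertex_mul_self, one_mul]

theorem scaledVertex_mul_vertex (c : k) (x : V) :
    scaledVertex k G c x * leavittVertex k G x = scaledVertex k G c x := by
  rw [← scaledVertex_one, scaledVertex_mul_self, mul_one]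

theorem src_mul_edge (e : E) :
    leavittVertex k G (G.src e) * leavittEdge k G e = leavittEdge k G e := by
  simpa [sub_eq_zero, leavittVertex, leavittEdge, leavittGhost] using
    toLeavitt_eq_zero G (Relator.src_mul_edge (k := k) (G := G) e)

theorem edge_mul_rng (e : E) :
    leavittEdge k G e * leavittVertex k G (G.rng e) = leavittEdge k G e := by
  simpa [sub_eq_zero, leavittVertex, leavittEdge, leavittGhost] using
    toLeavitt_eq_zero G (Relator.edge_mul_rng (k := k) (G := G) e)

theorem rng_mul_ghost (e : E) :
    leavittVertex k G (G.rng e) * leavittGhost k G e = leavittGhost k G e := by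
  simpa [sub_eq_zero, leavittVertex, leavittEdge, leavittGhost] using
    toLeavitt_eq_zero G (Relator.rng_mul_ghost (k := k) (G := G) e)

theorem ghost_mul_src (e : E) :
    leavittGhost k G e * leavittVertex k G (G.src e) = leavittGhost k G e := by
  simpa [sub_eq_zero, leavittVertex, leavittEdge, leavittGhost] using
    toLeavitt_eq_zero G (Relator.ghost_mul_src (k := k) (G := G) e)

theorem ghost_mul_edge_self (e : E) :
    leavittGhost k G e * leavittEdge k G e = leavittVertex k G (G.rng e) := by
  simpa [sub_eq_zero, leavittVertex, leavittEdge, leavittGhost] using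
    toLeavitt_eq_zero G (Relator.ghost_mul_edge_self (k := k) (G := G) e)

theorem ghost_mul_edge_of_ne {e f : E} (h : e ≠ f) :
    leavittGhost k G e * leavittEdge k G f = 0 := by
  simpa [leavittEdge, leavittGhost] using toLeavitt_eq_zero G (Relator.ghost_mul_edge_ne (k := k) (G := G) e f h)

theorem vertex_eq_sum {x : V} (hx : ¬ G.IsSink x) (hfin : {e : E | G.src e = x}.Finite) :
    leavittVertex k G x = ∑ e ∈ hfin.toFinset, leavittEdge k G e * leavittGhost k G e := by
  have := toLeavitt_eq_zero G (Relator.vertex_eq_sum (k := k) (G := G) x hx hfin)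
  simpa [sub_eq_zero, map_sum, leavittVertex, leavittEdge, leavittGhost] using this

/-- The scalar of a letter is moved to an adjacent vertex, so that only `scaledVertex` has to carry
coefficients. -/
theorem scaled_edge (c : k) (e : E) :
    toLeavitt k G (MonoidAlgebra.single (FreeSemigroup.of (.edge e)) c) =
      leavittEdge k G e * scaledVertex k G c (G.rng e) := by
  have := toLeavitt_smul_eq G (Relator.edge_mul_rng (k := k) (G := G) e) c
  rw [smul_gen, smul_gen_mul_gen'] at this
  rw [← this, map_mul]
  rfl

theorem scaled_ghost (c : k) (e : E) :
    toLeavitt k G (MonoidAlgebra.single (FreeSemigroup.of (.ghost e)) c) =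
      scaledVertex k G c (G.rng e) * leavittGhost k G e := by
  have := toLeavitt_smul_eq G (Relator.rng_mul_ghost (k := k) (G := G) e) c
  rw [smul_gen, smul_gen_mul_gen] at this
  rw [← this, map_mul]
  rfl

theorem vertex_mul_edge_of_ne {x : V} {e : E} (h : x ≠ G.src e) :
    leavittVertex k G x * leavittEdge k G e = 0 := by
  rw [← src_mul_edge, ← mul_assoc, vertex_mul_of_ne G h, zero_mul]

theorem ghost_mul_vertex_of_ne {x : V} {e : E} (h : G.src e ≠ x) :
    leavittGhost k G e * leavittVertex k G x = 0 := by
  rw [← ghost_mul_src, mul_assoc, vertex_mul_of_ne G h, mul_zero]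

theorem ghost_mul_scaledVertex_of_ne (c : k) {x : V} {e : E} (h : G.src e ≠ x) :
    leavittGhost k G e * scaledVertex k G c x = 0 := by
  rw [← vertex_mul_scaledVertex, ← mul_assoc, ghost_mul_vertex_of_ne G h, zero_mul]

theorem ghost_mul_scaledVertex (c : k) (e : E) :
    leavittGhost k G e * scaledVertex k G c (G.src e) =
      scaledVertex k G c (G.rng e) * leavittGhost k G e := by
  have := toLeavitt_smul_eq G (Relator.ghost_mul_src (k := k) (G := G) e) c
  rw [smul_gen, smul_gen_mul_gen'] at this
  rw [← scaled_ghost, ← this, map_mul]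
  rfl

/-! ### Degrees -/

theorem toLeavitt_single_mem (p : FreeSemigroup (PathGen V E)) (c : k) :
    toLeavitt k G (MonoidAlgebra.single p c) ∈ leavittGrading k G (wordDegree p) :=
  AddSubgroup.subset_closure ⟨p, c, rfl, rfl⟩

theorem scaledVertex_mem (c : k) (x : V) : scaledVertex k G c x ∈ leavittGrading k G 0 :=
  AddSubgroup.subset_closure ⟨FreeSemigroup.of (.vertex x), c, by
    simp [wordDegree, PathGen.degree], rfl⟩

theorem leavittEdge_mem (e : E) : leavittEdge k G e ∈ leavittGrading k G 1 :=
  AddSubgroup.subset_closure ⟨FreeSemigroup.of (.edge e), 1, by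
    simp [wordDegree, PathGen.degree], rfl⟩

theorem leavittGhost_mem (e : E) : leavittGhost k G e ∈ leavittGrading k G (-1) :=
  AddSubgroup.subset_closure ⟨FreeSemigroup.of (.ghost e), 1, by
    simp [wordDegree, PathGen.degree], rfl⟩

theorem wordDegree_of_mul (x : PathGen V E) (p : FreeSemigroup (PathGen V E)) :
    wordDegree (FreeSemigroup.of x * p) = x.degree + wordDegree p := by
  simp [wordDegree]

theorem leavitt_induction {motive : Leavitt k G → Prop} (a : Leavitt k G)
    (word : ∀ (p : FreeSemigroup (PathGen V E)) (c : k),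
      motive (toLeavitt k G (MonoidAlgebra.single p c)))
    (add : ∀ a b, motive a → motive b → motive (a + b)) (zero : motive 0) : motive a := by
  obtain ⟨y, rfl⟩ : ∃ y, toLeavitt k G y = a := Quotient.exists_rep a
  induction y using MonoidAlgebra.induction_linear with
  | zero => rwa [map_zero]
  | add f g hf hg => rw [map_add]; exact add _ _ hf hg
  | single p c => exact word p c

theorem closure_homogeneous_eq_top :
    AddSubgroup.closure {a : Leavitt k G | ∃ n, a ∈ leavittGrading k G n} = ⊤ := by
  refine top_unique fun a _ => ?_
  induction a using leavitt_induction with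
  | word p c => exact AddSubgroup.subset_closure ⟨_, toLeavitt_single_mem G p c⟩
  | add a b ha hb => exact add_mem (ha trivial) (hb trivial)
  | zero => exact zero_mem _

/-! ### Local units -/

theorem exists_vertex_mul_word (p : FreeSemigroup (PathGen V E)) (c : k) :
    ∃ x : V, leavittVertex k G x * toLeavitt k G (MonoidAlgebra.single p c) =
      toLeavitt k G (MonoidAlgebra.single p c) := by
  have key : ∀ (y : PathGen V E) (c : k), ∃ x : V,
      leavittVertex k G x * toLeavitt k G (MonoidAlgebra.single (FreeSemigroup.of y) c) =
      toLeavitt k G (MonoidAlgebra.single (FreeSemigroup.of y) c) := by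
    rintro (x | e | e) c
    · exact ⟨x, vertex_mul_scaledVertex G c x⟩
    · exact ⟨G.src e, by rw [scaled_edge, ← mul_assoc, src_mul_edge]⟩
    · exact ⟨G.rng e, by rw [scaled_ghost, ← mul_assoc, vertex_mul_scaledVertex]⟩
  induction p using FreeSemigroup.recOnMul with
  | ih1 y => exact key y c
  | ih2 y q _ _ =>
    obtain ⟨x, hx⟩ := key y 1
    refine ⟨x, ?_⟩
    rw [← one_mul c, ← MonoidAlgebra.single_mul_single, map_mul, ← mul_assoc, hx]

theorem exists_word_mul_vertex (p : FreeSemigroup (PathGen V E)) (c : k) :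
    ∃ x : V, toLeavitt k G (MonoidAlgebra.single p c) * leavittVertex k G x =
      toLeavitt k G (MonoidAlgebra.single p c) := by
  induction p using FreeSemigroup.recOnMul generalizing c with
  | ih1 y =>
    obtain x | e | e := y
    · exact ⟨x, scaledVertex_mul_vertex G c x⟩
    · exact ⟨G.rng e, by rw [scaled_edge, mul_assoc, scaledVertex_mul_vertex]⟩
    · exact ⟨G.src e, by rw [scaled_ghost, mul_assoc, ghost_mul_src]⟩
  | ih2 y q _ ih =>
    obtain ⟨x, hx⟩ := ih c
    refine ⟨x, ?_⟩
    rw [← one_mul c, ← MonoidAlgebra.single_mul_single, map_mul, mul_assoc, hx]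

/-- Sums of vertices are local units. Allowing every larger `F'` makes the claim additive in `a`:
the union of two finite sets serves both summands. -/
theorem exists_sum_vertex_mul (a : Leavitt k G) :
    ∃ F : Finset V, ∀ F' : Finset V, F ⊆ F' → ∑ x ∈ F', leavittVertex k G x * a = a := by
  classical
  induction a using leavitt_induction with
  | word p c =>
    obtain ⟨x, hx⟩ := exists_vertex_mul_word G p c
    refine ⟨{x}, fun F' hF => ?_⟩
    rw [Finset.sum_eq_single x, hx]
    · intro y _ hy
      rw [← hx, ← mul_assoc, vertex_mul_of_ne G hy, zero_mul]
    · intro h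
      exact absurd (hF (Finset.mem_singleton_self x)) h
  | add a b ha hb =>
    obtain ⟨F, hF⟩ := ha
    obtain ⟨F', hF'⟩ := hb
    refine ⟨F ∪ F', fun K hK => ?_⟩
    simp only [mul_add, Finset.sum_add_distrib]
    rw [hF K (Finset.union_subset_left hK), hF' K (Finset.union_subset_right hK)]
  | zero => exact ⟨∅, fun F' _ => by simp⟩

theorem exists_sum_mul_vertex (a : Leavitt k G) :
    ∃ F : Finset V, ∀ F' : Finset V, F ⊆ F' → ∑ x ∈ F', a * leavittVertex k G x = a := by
  classical
  induction a using leavitt_induction with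
  | word p c =>
    obtain ⟨x, hx⟩ := exists_word_mul_vertex G p c
    refine ⟨{x}, fun F' hF => ?_⟩
    rw [Finset.sum_eq_single x, hx]
    · intro y _ hy
      rw [← hx, mul_assoc, vertex_mul_of_ne G hy.symm, mul_zero]
    · intro h
      exact absurd (hF (Finset.mem_singleton_self x)) h
  | add a b ha hb =>
    obtain ⟨F, hF⟩ := ha
    obtain ⟨F', hF'⟩ := hb
    refine ⟨F ∪ F', fun K hK => ?_⟩
    simp only [add_mul, Finset.sum_add_distrib]
    rw [hF K (Finset.union_subset_left hK), hF' K (Finset.union_subset_right hK)]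
  | zero => exact ⟨∅, fun F' _ => by simp⟩

/-! ### Monomials -/

variable (k) in
/-- The scalar multiples of the ghosts `β*` of paths `β` of length `m`. -/
inductive IsGhostPath : ℕ → Leavitt k G → Prop
  | vertex (c : k) (x : V) : IsGhostPath 0 (scaledVertex k G c x)
  | mul_ghost {m : ℕ} {b : Leavitt k G} (hb : IsGhostPath m b) (e : E) :
      IsGhostPath (m + 1) (b * leavittGhost k G e)

variable (k) in
/-- The scalar multiples of the elements `α β*` of degree `n`, for paths `α` and `β`, where `α` has
length at most `i`. -/
inductive IsMonomial : ℕ → ℤ → Leavitt k G → Prop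
  | ghost {m : ℕ} {b : Leavitt k G} (hb : IsGhostPath k G m b) (i : ℕ) : IsMonomial i (-m) b
  | edge_mul {i : ℕ} {n : ℤ} {b : Leavitt k G} (e : E) (hb : IsMonomial i n b) :
      IsMonomial (i + 1) (1 + n) (leavittEdge k G e * b)

variable {G}

theorem IsGhostPath.vertex_mul {m : ℕ} {b : Leavitt k G} (hb : IsGhostPath k G m b) (x : V) :
    IsGhostPath k G m (leavittVertex k G x * b) := by
  induction hb with
  | vertex c y =>
    by_cases h : x = y
    · subst h
      rw [vertex_mul_scaledVertex]
      exact .vertex c x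
    -- A vanishing product still counts as a ghost path, with coefficient `0`.
    · rw [← scaledVertex_one, scaledVertex_mul_of_ne G _ _ h, ← scaledVertex_zero G x]
      exact .vertex 0 x
  | mul_ghost _ e ih =>
    rw [← mul_assoc]
    exact ih.mul_ghost e

theorem IsGhostPath.ghost_mul {m : ℕ} {b : Leavitt k G} (hb : IsGhostPath k G m b) (e : E) :
    IsGhostPath k G (m + 1) (leavittGhost k G e * b) := by
  induction hb with
  | vertex c y =>
    by_cases h : G.src e = y
    · subst h
      rw [ghost_mul_scaledVertex]
      exact (IsGhostPath.vertex c _).mul_ghost e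
    · rw [ghost_mul_scaledVertex_of_ne G _ h, ← zero_mul (leavittGhost k G e),
        ← scaledVertex_zero G y]
      exact (IsGhostPath.vertex 0 _).mul_ghost e
  | mul_ghost _ e ih =>
    rw [← mul_assoc]
    exact ih.mul_ghost e

variable (k G) in
/-- The span of the ghosts of paths of length `m`. -/
noncomputable def ghostSpan (m : ℕ) : AddSubgroup (Leavitt k G) :=
  AddSubgroup.closure {b | IsGhostPath k G m b}

variable (k G) in
/-- The span of the elements `α β*` of degree `n`, where `α` has length at most `i`. -/
noncomputable def monomialSpan (i : ℕ) (n : ℤ) : AddSubgroup (Leavitt k G) :=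
  AddSubgroup.closure {b | IsMonomial k G i n b}

theorem IsMonomial.mono {i : ℕ} {n : ℤ} {b : Leavitt k G} (hb : IsMonomial k G i n b) {j : ℕ}
    (h : i ≤ j) : IsMonomial k G j n b := by
  induction hb generalizing j with
  | ghost hb i => exact .ghost hb j
  | edge_mul e hb ih =>
    obtain ⟨j, rfl⟩ : ∃ j', j = j' + 1 := ⟨j - 1, by omega⟩
    exact .edge_mul e (ih (by omega))

theorem monomialSpan_mono {i j : ℕ} (h : i ≤ j) (n : ℤ) :
    monomialSpan k G i n ≤ monomialSpan k G j n :=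
  AddSubgroup.closure_mono fun _ hb => IsMonomial.mono hb h

theorem mul_left_mem_closure {A : Type*} [NonUnitalRing A] {S : Set A} {T : AddSubgroup A} {x a : A}
    (ha : a ∈ AddSubgroup.closure S) (h : ∀ b ∈ S, x * b ∈ T) : x * a ∈ T :=
  (AddSubgroup.closure_le (T.comap (AddMonoidHom.mulLeft x))).2 h ha

theorem mul_right_mem_closure {A : Type*} [NonUnitalRing A] {S : Set A} {T : AddSubgroup A}
    {x a : A} (ha : a ∈ AddSubgroup.closure S) (h : ∀ b ∈ S, b * x ∈ T) : a * x ∈ T :=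
  (AddSubgroup.closure_le (T.comap (AddMonoidHom.mulRight x))).2 h ha

theorem IsMonomial.vertex_mul {i : ℕ} {n : ℤ} {b : Leavitt k G} (hb : IsMonomial k G i n b)
    (x : V) : leavittVertex k G x * b ∈ monomialSpan k G i n := by
  cases hb with
  | ghost hb => exact AddSubgroup.subset_closure (.ghost (hb.vertex_mul x) i)
  | edge_mul e hb =>
    rw [← mul_assoc]
    by_cases h : x = G.src e
    · rw [h, src_mul_edge]
      exact AddSubgroup.subset_closure (.edge_mul e hb)
    · rw [vertex_mul_edge_of_ne G h, zero_mul]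
      exact zero_mem _

/-- If `α` is nontrivial, `e*` cancels its first edge or kills the term; otherwise `e*` only
lengthens the ghost path. Either way `i` edges are enough afterwards, which drives the induction on
`i`. -/
theorem IsMonomial.ghost_mul {i : ℕ} {n : ℤ} {b : Leavitt k G}
    (hb : IsMonomial k G (i + 1) n b) (e : E) :
    leavittGhost k G e * b ∈ monomialSpan k G i (-1 + n) := by
  cases hb with
  | @ghost m _ hb =>
    rw [show (-1 + -(m : ℤ)) = -((m + 1 : ℕ) : ℤ) by push_cast; ring]
    exact AddSubgroup.subset_closure (.ghost (hb.ghost_mul e) i)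
  | @edge_mul _ n b f hb =>
    rw [← mul_assoc, neg_add_cancel_left]
    by_cases h : e = f
    · rw [h, ghost_mul_edge_self]
      exact hb.vertex_mul _
    · rw [ghost_mul_edge_of_ne G h, zero_mul]
      exact zero_mem _

theorem IsMonomial.gen_mul {i : ℕ} {n : ℤ} {b : Leavitt k G} (hb : IsMonomial k G i n b)
    (y : PathGen V E) :
    toLeavitt k G (gen k y) * b ∈ monomialSpan k G (i + 1) (y.degree + n) := by
  obtain x | e | e := y
  · rw [PathGen.degree, zero_add]
    exact monomialSpan_mono i.le_succ n (hb.vertex_mul x)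
  · exact AddSubgroup.subset_closure (.edge_mul e hb)
  · exact monomialSpan_mono i.le_succ _ ((hb.mono i.le_succ).ghost_mul e)

theorem word_mem_monomialSpan (p : FreeSemigroup (PathGen V E)) (c : k) :
    ∃ i, toLeavitt k G (MonoidAlgebra.single p c) ∈ monomialSpan k G i (wordDegree p) := by
  induction p using FreeSemigroup.recOnMul with
  | ih1 y =>
    refine ⟨1, AddSubgroup.subset_closure ?_⟩
    obtain x | e | e := y
    · exact .ghost (.vertex c x) 1
    · rw [scaled_edge]
      exact .edge_mul e (.ghost (.vertex c _) 0)
    · rw [scaled_ghost]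
      exact .ghost (.mul_ghost (.vertex c _) e) 1
  | ih2 y q _ ih =>
    obtain ⟨i, hi⟩ := ih
    refine ⟨i + 1, ?_⟩
    rw [← one_mul c, ← MonoidAlgebra.single_mul_single, map_mul, wordDegree_of_mul]
    exact mul_left_mem_closure hi fun b hb => IsMonomial.gen_mul hb y

theorem exists_mem_monomialSpan {n : ℤ} {a : Leavitt k G} (ha : a ∈ leavittGrading k G n) :
    ∃ i, a ∈ monomialSpan k G i n := by
  induction ha using AddSubgroup.closure_induction with
  | mem a h =>
    obtain ⟨p, c, rfl, rfl⟩ := h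
    exact word_mem_monomialSpan p c
  | zero => exact ⟨0, zero_mem _⟩
  | add a b _ _ ha hb =>
    obtain ⟨i, hi⟩ := ha
    obtain ⟨j, hj⟩ := hb
    exact ⟨max i j, add_mem (monomialSpan_mono (le_max_left i j) n hi)
      (monomialSpan_mono (le_max_right i j) n hj)⟩
  | neg a _ ha =>
    obtain ⟨i, hi⟩ := ha
    exact ⟨i, neg_mem hi⟩

/-- No path `α` of positive length starts at a sink, so only the pure ghost terms survive. -/
theorem sink_mul_mem {x : V} (hx : G.IsSink x) {i : ℕ} {n : ℤ} {a : Leavitt k G}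
    (ha : a ∈ monomialSpan k G i n) : leavittVertex k G x * a ∈ monomialSpan k G 0 n := by
  refine mul_left_mem_closure ha fun b hb => ?_
  cases hb with
  | ghost hb => exact AddSubgroup.subset_closure (.ghost (hb.vertex_mul x) 0)
  | edge_mul e hb =>
    rw [← mul_assoc, vertex_mul_edge_of_ne G (hx e).symm, zero_mul]
    exact zero_mem _

theorem IsGhostPath.mul_vertex {m : ℕ} {b : Leavitt k G} (hb : IsGhostPath k G m b) (x : V) :
    b * leavittVertex k G x ∈ ghostSpan k G m := by
  cases hb with
  | vertex c y =>
    by_cases h : y = x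
    · subst h
      rw [scaledVertex_mul_vertex]
      exact AddSubgroup.subset_closure (.vertex c y)
    · rw [← scaledVertex_one, scaledVertex_mul_of_ne G _ _ h]
      exact zero_mem _
  | mul_ghost hb e =>
    rw [mul_assoc]
    by_cases h : G.src e = x
    · rw [← h, ghost_mul_src]
      exact AddSubgroup.subset_closure (.mul_ghost hb e)
    · rw [ghost_mul_vertex_of_ne G h, mul_zero]
      exact zero_mem _

theorem ghostSpan_mul_edge {m : ℕ} {a : Leavitt k G} (ha : a ∈ ghostSpan k G (m + 1)) (e : E) :
    a * leavittEdge k G e ∈ ghostSpan k G m := by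
  refine mul_right_mem_closure ha fun b hb => ?_
  cases hb with
  | mul_ghost hb f =>
    rw [mul_assoc]
    by_cases h : f = e
    · rw [h, ghost_mul_edge_self]
      exact hb.mul_vertex _
    · rw [ghost_mul_edge_of_ne G h, mul_zero]
      exact zero_mem _

/-- A ghost path of positive length ends in some `f*`, and the source of `f` is not a sink. -/
theorem ghostSpan_mul_sink {x : V} (hx : G.IsSink x) {m : ℕ} {a : Leavitt k G}
    (ha : a ∈ ghostSpan k G (m + 1)) : a * leavittVertex k G x = 0 := by
  rw [← AddSubgroup.mem_bot]
  refine mul_right_mem_closure ha fun b hb => ?_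
  cases hb with
  | mul_ghost hb f =>
    rw [AddSubgroup.mem_bot, mul_assoc, ghost_mul_vertex_of_ne G (hx f), mul_zero]

/-! ### Reduction of homogeneous elements to vertices -/

variable (k G) in
/-- The span of the elements `x u y` of degree `n`, where `u` is a vertex of the form `x' a y'`, with
`x'` and `y'` of the degrees opposite to those of `x` and `y`. -/
noncomputable def reductions (n : ℤ) (a : Leavitt k G) : AddSubgroup (Leavitt k G) :=
  AddSubgroup.closure {z | ∃ (u : V) (i : ℤ) (x y x' y' : Leavitt k G),
    x ∈ leavittGrading k G i ∧ y ∈ leavittGrading k G (n - i) ∧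
    x' ∈ leavittGrading k G (-i) ∧ y' ∈ leavittGrading k G (i - n) ∧
    x' * a * y' = leavittVertex k G u ∧ z = x * leavittVertex k G u * y}

/-- A vertex recovered from `b' a` is recovered from `a` by absorbing `b'` into the left factor
`x'`; on the other side `b` is absorbed into `x`. The degrees of `b` and `b'` cancel. -/
theorem mul_mem_reductions {n d m : ℤ} {a b b' z : Leavitt k G} (hb : b ∈ leavittGrading k G d)
    (hb' : b' ∈ leavittGrading k G (-d)) (hn : d + m = n) (hz : z ∈ reductions k G m (b' * a)) :
    b * z ∈ reductions k G n a := by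
  refine mul_left_mem_closure hz ?_
  rintro _ ⟨u, i, x, y, x', y', hx, hy, hx', hy', h, rfl⟩
  refine AddSubgroup.subset_closure ⟨u, d + i, b * x, y, x' * b', y', SetLike.mul_mem_graded hb hx,
    ?_, ?_, ?_, ?_, ?_⟩
  · rwa [← hn, add_sub_add_left_eq_sub]
  · rw [neg_add_rev]
    exact SetLike.mul_mem_graded hx' hb'
  · rwa [← hn, add_sub_add_left_eq_sub]
  · rw [← h, mul_assoc x']
  · simp only [mul_assoc]

theorem mem_reductions_mul {n d m : ℤ} {a b b' z : Leavitt k G} (hb : b ∈ leavittGrading k G d)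
    (hb' : b' ∈ leavittGrading k G (-d)) (hn : m + d = n) (hz : z ∈ reductions k G m (a * b')) :
    z * b ∈ reductions k G n a := by
  refine mul_right_mem_closure hz ?_
  rintro _ ⟨u, i, x, y, x', y', hx, hy, hx', hy', h, rfl⟩
  refine AddSubgroup.subset_closure ⟨u, i, x, y * b, x', b' * y', hx,
    ?_, hx', ?_, ?_, ?_⟩
  · rw [← hn, add_sub_right_comm]
    exact SetLike.mul_mem_graded hy hb
  · rw [← hn, show i - (m + d) = -d + (i - m) by ring]
    exact SetLike.mul_mem_graded hb' hy'
  · rw [← h]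
    simp only [mul_assoc]
  · simp only [mul_assoc]

/-- Expand `x = ∑ e e*` and pass from each `e* a` back to `a`. This reduces the claim to elements
with shorter `α`. -/
theorem vertex_mul_mem_reductions (hG : G.IsRowFinite) {n : ℤ} {a : Leavitt k G} {x : V}
    (hx : ¬ G.IsSink x)
    (h : ∀ e : E, leavittGhost k G e * a ∈ reductions k G (-1 + n) (leavittGhost k G e * a)) :
    leavittVertex k G x * a ∈ reductions k G n a := by
  rw [vertex_eq_sum G hx (hG x), Finset.sum_mul]
  refine sum_mem fun e _ => ?_
  rw [mul_assoc]
  exact mul_mem_reductions (leavittEdge_mem G e) (leavittGhost_mem G e) (by ring) (h e)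

theorem mul_vertex_mem_reductions (hG : G.IsRowFinite) {n : ℤ} {a : Leavitt k G} {x : V}
    (hx : ¬ G.IsSink x)
    (h : ∀ e : E, a * leavittEdge k G e ∈ reductions k G (n + 1) (a * leavittEdge k G e)) :
    a * leavittVertex k G x ∈ reductions k G n a := by
  rw [vertex_eq_sum G hx (hG x), Finset.mul_sum]
  refine sum_mem fun e _ => ?_
  rw [← mul_assoc]
  refine mem_reductions_mul (leavittGhost_mem G e) ?_ (by ring) (h e)
  rw [neg_neg]
  exact leavittEdge_mem G e

/-- Here `a` is a linear combination of vertices, so `x a = c x`; if `c ≠ 0`, then `x` is recovered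
as `(c⁻¹ x) a x`. -/
theorem ghostSpan_zero_mem_reductions {a : Leavitt k G} (ha : a ∈ ghostSpan k G 0) :
    a ∈ reductions k G 0 a := by
  have key : ∀ x : V, ∃ c : k, leavittVertex k G x * a = scaledVertex k G c x := by
    intro x
    induction ha using AddSubgroup.closure_induction with
    | mem a h =>
      cases h with
      | vertex c y =>
        by_cases h : x = y
        · exact ⟨c, by rw [h, vertex_mul_scaledVertex]⟩
        · exact ⟨0, by rw [← scaledVertex_one, scaledVertex_mul_of_ne G _ _ h, scaledVertex_zero]⟩
    | zero => exact ⟨0, by rw [mul_zero, scaledVertex_zero]⟩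
    | add a b _ _ ha hb =>
      obtain ⟨c, hc⟩ := ha
      obtain ⟨d, hd⟩ := hb
      exact ⟨c + d, by rw [mul_add, hc, hd, scaledVertex_add]⟩
    | neg a _ ha =>
      obtain ⟨c, hc⟩ := ha
      exact ⟨-c, by rw [mul_neg, hc, scaledVertex_neg]⟩
  obtain ⟨F, hF⟩ := exists_sum_vertex_mul G a
  -- Quantifying over `T` confines the rewriting to the element: the `a` that is a parameter of
  -- `reductions` must stay unchanged.
  rw [show ∀ T : AddSubgroup (Leavitt k G), a ∈ T ↔ ∑ x ∈ F, leavittVertex k G x * a ∈ T from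
    fun T => by rw [hF F subset_rfl]]
  refine sum_mem fun x _ => ?_
  obtain ⟨c, hc⟩ := key x
  rw [hc]
  by_cases h0 : c = 0
  · rw [h0, scaledVertex_zero]
    exact zero_mem _
  refine AddSubgroup.subset_closure ⟨x, 0, scaledVertex k G c x, leavittVertex k G x,
    scaledVertex k G c⁻¹ x, leavittVertex k G x, scaledVertex_mem G c x, leavittVertex_mem k G x,
    scaledVertex_mem G _ x, leavittVertex_mem k G x, ?_, ?_⟩
  · rw [← scaledVertex_mul_vertex, mul_assoc (scaledVertex k G c⁻¹ x), hc, scaledVertex_mul_self,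
      inv_mul_cancel₀ h0, scaledVertex_one, leavittVertex_mul_self]
  · rw [scaledVertex_mul_vertex, scaledVertex_mul_vertex]

/-- Induction on the length: at a sink `a x` vanishes, and elsewhere `a x = ∑ (a e) e*` with shorter
ghosts in `a e`. -/
theorem ghostSpan_mem_reductions (hG : G.IsRowFinite) (m : ℕ) {a : Leavitt k G}
    (ha : a ∈ ghostSpan k G m) : a ∈ reductions k G (-m) a := by
  induction m generalizing a with
  | zero => simpa using ghostSpan_zero_mem_reductions ha
  | succ m ih =>
    obtain ⟨F, hF⟩ := exists_sum_mul_vertex G a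
    rw [show ∀ T : AddSubgroup (Leavitt k G), a ∈ T ↔ ∑ x ∈ F, a * leavittVertex k G x ∈ T from
      fun T => by rw [hF F subset_rfl]]
    refine sum_mem fun x _ => ?_
    by_cases hx : G.IsSink x
    · rw [ghostSpan_mul_sink hx ha]
      exact zero_mem _
    · refine mul_vertex_mem_reductions hG hx fun e => ?_
      rw [show (-((m + 1 : ℕ) : ℤ) + 1) = -m by push_cast; ring]
      exact ih (ghostSpan_mul_edge ha e)

theorem monomialSpan_zero_mem_reductions (hG : G.IsRowFinite) {n : ℤ} {a : Leavitt k G}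
    (ha : a ∈ monomialSpan k G 0 n) : a ∈ reductions k G n a := by
  -- Without real edges the degree determines the ghost length, so lengths cannot mix in a nonzero
  -- `a`.
  have key : a = 0 ∨ ∃ m : ℕ, n = -m ∧ a ∈ ghostSpan k G m := by
    induction ha using AddSubgroup.closure_induction with
    | mem a h =>
      cases h with
      | @ghost m _ hb => exact .inr ⟨m, rfl, AddSubgroup.subset_closure hb⟩
    | zero => exact .inl rfl
    | add a b _ _ ha hb =>
      obtain rfl | ⟨m, hm, ha⟩ := ha
      · rwa [zero_add]
      obtain rfl | ⟨m', hm', hb⟩ := hb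
      · rw [add_zero]
        exact .inr ⟨m, hm, ha⟩
      obtain rfl : m = m' := by omega
      exact .inr ⟨m, hm, add_mem ha hb⟩
    | neg a _ ha =>
      obtain rfl | ⟨m, hm, ha⟩ := ha
      · exact .inl neg_zero
      · exact .inr ⟨m, hm, neg_mem ha⟩
  clear ha
  obtain rfl | ⟨m, rfl, ha⟩ := key
  · exact zero_mem _
  · exact ghostSpan_mem_reductions hG m ha

theorem monomialSpan_mem_reductions (hG : G.IsRowFinite) (i : ℕ) {n : ℤ} {a : Leavitt k G}
    (ha : a ∈ monomialSpan k G i n) : a ∈ reductions k G n a := by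
  induction i generalizing n a with
  | zero => exact monomialSpan_zero_mem_reductions hG ha
  | succ i ih =>
    obtain ⟨F, hF⟩ := exists_sum_vertex_mul G a
    rw [show ∀ T : AddSubgroup (Leavitt k G), a ∈ T ↔ ∑ x ∈ F, leavittVertex k G x * a ∈ T from
      fun T => by rw [hF F subset_rfl]]
    refine sum_mem fun x _ => ?_
    by_cases hx : G.IsSink x
    -- Writing `x a = x (x a)` lets the pure ghost element `x a` be reduced first, and the reduction
    -- is then transferred to `a`.
    · rw [← leavittVertex_mul_self, mul_assoc]
      exact mul_mem_reductions (leavittVertex_mem k G x) (leavittVertex_mem k G x) (zero_add n)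
        (monomialSpan_zero_mem_reductions hG (sink_mul_mem hx ha))
    · exact vertex_mul_mem_reductions hG hx fun e =>
        ih (mul_left_mem_closure ha fun b hb => IsMonomial.ghost_mul hb e)

/-- A homogeneous element `a` is a sum of elements `x u y` of its degree, where every `u` is a
vertex that can be recovered from `a`. -/
theorem mem_reductions (hG : G.IsRowFinite) {n : ℤ} {a : Leavitt k G}
    (ha : a ∈ leavittGrading k G n) : a ∈ reductions k G n a :=
  (exists_mem_monomialSpan ha).elim fun i hi => monomialSpan_mem_reductions hG i hi

end DirGraph

namespace DirGraph

/-! ### A representation that kills a given hereditary saturated set -/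

/-- The linear endomorphism of the functions on `X` induced by a partial map of `X`. -/
def partialComp (k : Type w) [Field k] {X : Type u} (g : X → Option X) : Module.End k (X → k) where
  toFun f x := (g x).elim 0 f
  map_add' f f' := by
    ext x
    cases h : g x <;> simp [h]
  map_smul' c f := by
    ext x
    cases h : g x <;> simp [h]

theorem partialComp_apply (k : Type w) [Field k] {X : Type u} (g : X → Option X) (f : X → k)
    (x : X) : partialComp k g f x = (g x).elim 0 f := rfl

/-- Composition with a map is contravariant: in a product, the left factor moves the point first, so
words act on points from left to right. -/
theorem partialComp_mul (k : Type w) [Field k] {X : Type u} (g h : X → Option X) :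
    partialComp k g * partialComp k h = partialComp k fun x => (g x).bind h := by
  ext f x
  simp only [Module.End.mul_apply, partialComp_apply]
  cases g x <;> simp [partialComp_apply]

theorem partialComp_none (k : Type w) [Field k] {X : Type u} :
    partialComp k (fun _ : X => none) = 0 := rfl

variable (k : Type w) [Field k] {V : Type u} {E : Type v} {G : DirGraph V E}

open Classical in
/-- The partial maps by which the generators act on `V × ℕ`. -/
noncomputable def genMap (G : DirGraph V E) (H : Set V) (ψ : E → ℕ → ℕ) :
    PathGen V E → V × ℕ → Option (V × ℕ)
  | .vertex x, z => if z.1 = x ∧ x ∉ H then some z else none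
  | .ghost e, z => if z.1 = G.rng e ∧ G.rng e ∉ H then some (G.src e, ψ e z.2) else none
  | .edge e, z =>
    if h : (z.1 = G.src e ∧ G.rng e ∉ H) ∧ ∃ n, ψ e n = z.2 then some (G.rng e, h.2.choose)
    else none

/-- The representation of the free path algebra on the functions on `V × ℕ`. -/
noncomputable def freeRep (G : DirGraph V E) (H : Set V) (ψ : E → ℕ → ℕ) :
    FreePathAlgebra k V E →ₙₐ[k] Module.End k (V × ℕ → k) :=
  MonoidAlgebra.liftMagma k (FreeSemigroup.lift fun x => partialComp k (genMap G H ψ x))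

theorem freeRep_gen (G : DirGraph V E) (H : Set V) (ψ : E → ℕ → ℕ) (x : PathGen V E) :
    freeRep k G H ψ (gen k x) = partialComp k (genMap G H ψ x) := by
  simp [freeRep, gen, MonoidAlgebra.liftMagma_apply_apply]

/-- Every vertex carries a copy of `ℕ`. For a non-sink `x ∉ H`, the set `T` of edges from `x` that
end outside `H` is finite, and nonempty by saturation. A bijection `T × ℕ ≃ ℕ` therefore cuts the
copy over `x` into the images of the copies over the ranges, as the relation `x = ∑ e e*` requires.
-/
theorem exists_branching (hG : G.IsRowFinite) {H : Set V} (hs : G.IsSaturated H) :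
    ∃ ψ : E → ℕ → ℕ,
      (∀ e f m n, G.src e = G.src f → G.rng e ∉ H → G.rng f ∉ H → ψ e m = ψ f n →
        e = f ∧ m = n) ∧
      ∀ x ∉ H, ¬ G.IsSink x → ∀ m, ∃ e n, G.src e = x ∧ G.rng e ∉ H ∧ ψ e n = m := by
  classical
  have key : ∀ x : V, ∃ ψ : E → ℕ → ℕ,
      (∀ e f m n, G.src e = x → G.src f = x → G.rng e ∉ H → G.rng f ∉ H → ψ e m = ψ f n →
        e = f ∧ m = n) ∧
      (x ∉ H → ¬ G.IsSink x → ∀ m, ∃ e n, G.src e = x ∧ G.rng e ∉ H ∧ ψ e n = m) := by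
    intro x
    let T := {e : E // G.src e = x ∧ G.rng e ∉ H}
    by_cases hT : Nonempty T
    · have : Finite T := ((hG x).subset fun e he => he.1).to_subtype
      obtain ⟨d⟩ := nonempty_denumerable (T × ℕ)
      let φ : T × ℕ ≃ ℕ := Denumerable.eqv _
      refine ⟨fun e n => if h : G.src e = x ∧ G.rng e ∉ H then φ (⟨e, h⟩, n) else 0, ?_, ?_⟩
      · intro e f m n he hf he' hf' h
        beta_reduce at h
        rw [dif_pos ⟨he, he'⟩, dif_pos ⟨hf, hf'⟩] at h
        have h' := φ.injective h
        exact ⟨congrArg (fun t => t.1.1) h', congrArg Prod.snd h'⟩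
      · intro _ _ m
        refine ⟨(φ.symm m).1.1, (φ.symm m).2, (φ.symm m).1.2.1, (φ.symm m).1.2.2, ?_⟩
        beta_reduce
        rw [dif_pos (φ.symm m).1.2]
        exact φ.apply_symm_apply m
    · refine ⟨fun _ _ => 0, ?_, ?_⟩
      · intro e f m n he hf he' hf' h
        exact absurd ⟨⟨e, he, he'⟩⟩ hT
      · intro hx hx' m
        refine absurd (hs x hx' fun e he => ?_) hx
        by_contra h
        exact hT ⟨⟨e, he, h⟩⟩
  choose ψ h1 h2 using key
  refine ⟨fun e => ψ (G.src e) e, ?_, ?_⟩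
  · intro e f m n h he hf hψ
    refine h1 (G.src e) e f m n rfl h.symm he hf ?_
    beta_reduce at hψ
    rw [hψ, h]
  · intro x hx hx' m
    obtain ⟨e, n, he, he', h⟩ := h2 x hx hx' m
    exact ⟨e, n, he, he', by beta_reduce; rw [he, h]⟩

section genMap

variable {H : Set V} {ψ : E → ℕ → ℕ} {z : V × ℕ}

theorem genMap_vertex_of {x : V} (h : z.1 = x) (hx : x ∉ H) :
    genMap G H ψ (.vertex x) z = some z := if_pos ⟨h, hx⟩

theorem genMap_vertex_none {x : V} (h : ¬ (z.1 = x ∧ x ∉ H)) :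
    genMap G H ψ (.vertex x) z = none := if_neg h

theorem genMap_ghost_of {e : E} (h : z.1 = G.rng e) (he : G.rng e ∉ H) :
    genMap G H ψ (.ghost e) z = some (G.src e, ψ e z.2) := if_pos ⟨h, he⟩

theorem genMap_ghost_none {e : E} (h : ¬ (z.1 = G.rng e ∧ G.rng e ∉ H)) :
    genMap G H ψ (.ghost e) z = none := if_neg h

theorem genMap_edge_of {e : E} {n : ℕ} (h : z.1 = G.src e) (he : G.rng e ∉ H) (hn : ψ e n = z.2)
    (hinj : ∀ m n, ψ e m = ψ e n → m = n) : genMap G H ψ (.edge e) z = some (G.rng e, n) := by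
  have hex : (z.1 = G.src e ∧ G.rng e ∉ H) ∧ ∃ n, ψ e n = z.2 := ⟨⟨h, he⟩, n, hn⟩
  exact (dif_pos hex).trans (congrArg some
    (Prod.ext rfl (hinj _ _ (hex.2.choose_spec.trans hn.symm))))

theorem genMap_edge_none {e : E} (h : ¬ ((z.1 = G.src e ∧ G.rng e ∉ H) ∧ ∃ n, ψ e n = z.2)) :
    genMap G H ψ (.edge e) z = none := dif_neg h

end genMap

/-- The ghost `e*` acts through the embedding `ψ e` and `e` through its partial inverse. Heredity
enters as `hsrc`: an edge that acts nontrivially has its source outside `H` too. The disjoint images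
in `h1` give `e* f = 0`, and the covering in `h2` is needed only for the last relation. -/
theorem freeRep_relator {H : Set V} (hh : G.IsHereditary H) {ψ : E → ℕ → ℕ}
    (h1 : ∀ e f m n, G.src e = G.src f → G.rng e ∉ H → G.rng f ∉ H → ψ e m = ψ f n →
        e = f ∧ m = n)
    (h2 : ∀ x ∉ H, ¬ G.IsSink x → ∀ m, ∃ e n, G.src e = x ∧ G.rng e ∉ H ∧ ψ e n = m)
    {y : FreePathAlgebra k V E} (hy : Relator k G y) : freeRep k G H ψ y = 0 := by
  have hsrc : ∀ e, G.rng e ∉ H → G.src e ∉ H := fun e he h => he (hh e h)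
  have hinj : ∀ e, G.rng e ∉ H → ∀ m n, ψ e m = ψ e n → m = n := fun e he m n h =>
    (h1 e e m n rfl he he h).2
  cases hy with
  | vertex_mul_self x =>
    rw [map_sub, map_mul, freeRep_gen, partialComp_mul, sub_eq_zero]
    congr 1
    ext1 z
    by_cases h : z.1 = x ∧ x ∉ H
    · rw [genMap_vertex_of h.1 h.2, Option.bind_some, genMap_vertex_of h.1 h.2]
    · rw [genMap_vertex_none h, Option.bind_none]
  | vertex_mul_ne x y hxy =>
    rw [map_mul, freeRep_gen, freeRep_gen, partialComp_mul, ← partialComp_none]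
    congr 1
    ext1 z
    by_cases h : z.1 = x ∧ x ∉ H
    · rw [genMap_vertex_of h.1 h.2, Option.bind_some, genMap_vertex_none]
      exact fun h' => hxy (h.1.symm.trans h'.1)
    · rw [genMap_vertex_none h, Option.bind_none]
  | src_mul_edge e =>
    rw [map_sub, map_mul, freeRep_gen, freeRep_gen, partialComp_mul, sub_eq_zero]
    congr 1
    ext1 z
    by_cases h : z.1 = G.src e ∧ G.src e ∉ H
    · rw [genMap_vertex_of h.1 h.2, Option.bind_some]
    · rw [genMap_vertex_none h, Option.bind_none, genMap_edge_none]
      exact fun h' => h ⟨h'.1.1, hsrc e h'.1.2⟩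
  | edge_mul_rng e =>
    rw [map_sub, map_mul, freeRep_gen, freeRep_gen, partialComp_mul, sub_eq_zero]
    congr 1
    ext1 z
    by_cases h : (z.1 = G.src e ∧ G.rng e ∉ H) ∧ ∃ n, ψ e n = z.2
    · obtain ⟨⟨h3, h4⟩, n, h5⟩ := h
      rw [genMap_edge_of h3 h4 h5 (hinj e h4), Option.bind_some,
        genMap_vertex_of (x := G.rng e) rfl h4]
    · rw [genMap_edge_none h, Option.bind_none]
  | rng_mul_ghost e =>
    rw [map_sub, map_mul, freeRep_gen, freeRep_gen, partialComp_mul, sub_eq_zero]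
    congr 1
    ext1 z
    by_cases h : z.1 = G.rng e ∧ G.rng e ∉ H
    · rw [genMap_vertex_of h.1 h.2, Option.bind_some]
    · rw [genMap_vertex_none h, Option.bind_none, genMap_ghost_none h]
  | ghost_mul_src e =>
    rw [map_sub, map_mul, freeRep_gen, freeRep_gen, partialComp_mul, sub_eq_zero]
    congr 1
    ext1 z
    by_cases h : z.1 = G.rng e ∧ G.rng e ∉ H
    · rw [genMap_ghost_of h.1 h.2, Option.bind_some,
        genMap_vertex_of (x := G.src e) rfl (hsrc e h.2)]
    · rw [genMap_ghost_none h, Option.bind_none]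
  | ghost_mul_edge_self e =>
    rw [map_sub, map_mul, freeRep_gen, freeRep_gen, freeRep_gen, partialComp_mul, sub_eq_zero]
    congr 1
    ext1 z
    by_cases h : z.1 = G.rng e ∧ G.rng e ∉ H
    · rw [genMap_ghost_of h.1 h.2, Option.bind_some, genMap_edge_of rfl h.2 rfl (hinj e h.2),
        genMap_vertex_of h.1 h.2, ← h.1]
    · rw [genMap_ghost_none h, Option.bind_none, genMap_vertex_none h]
  | ghost_mul_edge_ne e f hef =>
    rw [map_mul, freeRep_gen, freeRep_gen, partialComp_mul, ← partialComp_none]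
    congr 1
    ext1 z
    by_cases h : z.1 = G.rng e ∧ G.rng e ∉ H
    · rw [genMap_ghost_of h.1 h.2, Option.bind_some, genMap_edge_none]
      rintro ⟨⟨h3, h4⟩, n, h5⟩
      exact hef (h1 f e n z.2 h3.symm h4 h.2 h5).1.symm
    · rw [genMap_ghost_none h, Option.bind_none]
  | vertex_eq_sum x hx hfin =>
    rw [map_sub, map_sum, sub_eq_zero]
    simp only [map_mul, freeRep_gen, partialComp_mul]
    refine LinearMap.ext fun f => funext fun z => ?_
    rw [LinearMap.sum_apply, Finset.sum_apply]
    simp only [partialComp_apply]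
    by_cases h : z.1 = x ∧ x ∉ H
    -- The point `z` lies in the image of exactly one `ψ e`, so a single summand survives.
    · obtain ⟨e, n, he, he', hn⟩ := h2 x h.2 hx z.2
      have hz : z.1 = G.src e := h.1.trans he.symm
      rw [Finset.sum_eq_single e, genMap_edge_of hz he' hn (hinj e he'), Option.bind_some,
        genMap_ghost_of rfl he', genMap_vertex_of h.1 h.2, hn, ← hz]
      · intro e' _ hne
        rw [genMap_edge_none]
        · rfl
        rintro ⟨⟨h3, h4⟩, n', h5⟩
        exact hne (h1 e' e n' n (h3.symm.trans hz) h4 he' (h5.trans hn.symm)).1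
      · intro hmem
        exact absurd (hfin.mem_toFinset.2 he) hmem
    · rw [genMap_vertex_none h]
      refine (Finset.sum_eq_zero fun e he => ?_).symm
      rw [genMap_edge_none]
      · rfl
      rintro ⟨⟨h3, h4⟩, -⟩
      have he : G.src e = x := hfin.mem_toFinset.1 he
      exact h ⟨h3.trans he, he ▸ hsrc e h4⟩

/-- The vertices in the ideal generated by a hereditary saturated set `H` lie in `H`. -/
theorem mem_of_vertex_mem_span (hG : G.IsRowFinite) {H : Set V} (hh : G.IsHereditary H)
    (hs : G.IsSaturated H) {x : V}
    (hx : leavittVertex k G x ∈ TwoSidedIdeal.span (leavittVertex k G '' H)) : x ∈ H := by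
  obtain ⟨ψ, h1, h2⟩ := exists_branching hG hs
  set ρ := freeRep k G H ψ
  have hker : relatorIdeal k G ≤ TwoSidedIdeal.ker ρ := by
    refine TwoSidedIdeal.span_le.2 ?_
    rintro _ ⟨c, y, hy, rfl⟩
    refine (TwoSidedIdeal.mem_ker ρ).2 ?_
    rw [map_smul, freeRep_relator k hh h1 h2 hy, smul_zero]
  have hwd : ∀ y z, toLeavitt k G y = toLeavitt k G z → ρ y = ρ z := by
    intro y z h
    have h' : y - z ∈ relatorIdeal k G := (TwoSidedIdeal.rel_iff _ _ _).1 ((RingCon.eq _).1 h)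
    rw [← sub_eq_zero, ← map_sub]
    exact (TwoSidedIdeal.mem_ker ρ).1 (hker h')
  have hsurj : ∀ a, ∃ y, toLeavitt k G y = a := Quotient.exists_rep
  -- The image in `L(E)` of the kernel of `ρ`, described by all lifts of an element; `hwd` makes the
  -- choice of lift immaterial.
  let T : TwoSidedIdeal (Leavitt k G) :=
    TwoSidedIdeal.mk' {a | ∀ y, toLeavitt k G y = a → ρ y = 0}
      (fun y h => by rw [hwd y 0 (h.trans (map_zero _).symm), map_zero])
      (by
        intro a b ha hb y hy
        obtain ⟨a, rfl⟩ := hsurj a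
        obtain ⟨b, rfl⟩ := hsurj b
        rw [hwd y (a + b) (hy.trans (map_add _ _ _).symm), map_add, ha a rfl, hb b rfl, add_zero])
      (by
        intro a ha y hy
        obtain ⟨a, rfl⟩ := hsurj a
        rw [hwd y (-a) (hy.trans (map_neg _ _).symm), map_neg, ha a rfl, neg_zero])
      (by
        intro a b hb y hy
        obtain ⟨a, rfl⟩ := hsurj a
        obtain ⟨b, rfl⟩ := hsurj b
        rw [hwd y (a * b) (hy.trans (map_mul _ _ _).symm), map_mul, hb b rfl, mul_zero])
      (by
        intro a b ha y hy
        obtain ⟨a, rfl⟩ := hsurj a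
        obtain ⟨b, rfl⟩ := hsurj b
        rw [hwd y (a * b) (hy.trans (map_mul _ _ _).symm), map_mul, ha a rfl, zero_mul])
  have hT : ∀ a, a ∈ T ↔ ∀ y, toLeavitt k G y = a → ρ y = 0 := fun a =>
    TwoSidedIdeal.mem_mk' _ _ _ _ _ _ _
  have hle : TwoSidedIdeal.span (leavittVertex k G '' H) ≤ T := by
    refine TwoSidedIdeal.span_le.2 ?_
    rintro _ ⟨z, hz, rfl⟩
    refine (hT _).2 fun y hy => ?_
    rw [hwd y _ hy, freeRep_gen]
    ext f t
    simp [partialComp_apply, genMap, hz]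
  by_contra hxH
  have h0 := (hT _).1 (hle hx) _ rfl
  rw [freeRep_gen] at h0
  -- A vertex outside `H` fixes its own points, so the constant function `1` keeps the value `1` at
  -- `(x, 0)`.
  have := congrFun (LinearMap.congr_fun h0 fun _ => 1) (x, 0)
  simp [partialComp_apply, genMap, hxH] at this

end DirGraph

/-! ### Order ideals of `V^gr` and ideals of the ring -/

namespace OrderIdeal

variable {Γ : Type v} {M : Type u} [Group Γ] [AddCommMonoid M] [DistribMulAction Γ M]
  (N : OrderIdeal Γ M)

theorem add_mem {a b : M} (ha : a ∈ N) (hb : b ∈ N) : a + b ∈ N := N.add_mem' ha hb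

theorem zero_mem : (0 : M) ∈ N := N.zero_mem'

theorem smul_mem (g : Γ) {a : M} (ha : a ∈ N) : g • a ∈ N := N.smul_mem' g a ha

theorem mem_of_add_mem {a c : M} (h : a + c ∈ N) : a ∈ N := N.hereditary' a _ ⟨c, rfl⟩ h

end OrderIdeal

/-! ### Block matrices over a ring without unit -/

namespace Matrix

variable {A : Type u} [NonUnitalRing A] {l m n m₁ m₂ n₁ n₂ : Type}

theorem nonUnital_fromCols_mul_fromRows [Fintype m₁] [Fintype m₂] (x : Matrix l m₁ A)
    (x' : Matrix l m₂ A) (y : Matrix m₁ n A) (y' : Matrix m₂ n A) :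
    fromCols x x' * fromRows y y' = x * y + x' * y' := by
  ext i j
  simp [mul_apply]

theorem nonUnital_fromRows_mul_fromCols [Fintype m] (y : Matrix n₁ m A) (y' : Matrix n₂ m A)
    (x : Matrix m m₁ A) (x' : Matrix m m₂ A) :
    fromRows y y' * fromCols x x' = fromBlocks (y * x) (y * x') (y' * x) (y' * x') := by
  ext (i | i) (j | j) <;> simp [mul_apply]

theorem nonUnital_fromCols_mul_fromBlocks_diagonal [Fintype m₁] [Fintype m₂]
    (x : Matrix l m₁ A) (x' : Matrix l m₂ A) (p : Matrix m₁ m₁ A) (p' : Matrix m₂ m₂ A) :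
    fromCols x x' * fromBlocks p 0 0 p' = fromCols (x * p) (x' * p') := by
  ext i (j | j) <;> simp [mul_apply]

end Matrix

/-! ### Direct summands and factorizations of idempotents -/

namespace GradedIdempotent

variable {A : Type u} [NonUnitalRing A] {𝒜 : ℤ → AddSubgroup A}

/-- From `q = q² = (y x)(y x)` follows `q = y p x`. -/
theorem Equivalent.entries_mem {P Q : GradedIdempotent 𝒜} (h : Equivalent P Q)
    {J : TwoSidedIdeal A} (hP : ∀ i j, P.p i j ∈ J) (i j : Q.ι) : Q.p i j ∈ J := by
  obtain ⟨x, y, -, -, h1, h2⟩ := h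
  have : Q.p = y * (P.p * x) := by
    rw [← Q.idem, ← h2, ← h1]
    simp only [Matrix.mul_assoc]
  rw [this, Matrix.mul_apply]
  refine sum_mem fun t _ => J.mul_mem_left _ _ ?_
  rw [Matrix.mul_apply]
  exact sum_mem fun s _ => J.mul_mem_right _ _ (hP _ _)

variable [SetLike.GradedMul 𝒜]

/-- If `p = x q y`, then the module of `p` is a direct summand of the module of `q`. -/
theorem exists_mk_eq_add {P Q : GradedIdempotent 𝒜} {x : Matrix P.ι Q.ι A} {y : Matrix Q.ι P.ι A}
    (hx : ∀ i j, x i j ∈ 𝒜 (Q.d j - P.d i)) (hy : ∀ j i, y j i ∈ 𝒜 (P.d i - Q.d j))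
    (h : x * Q.p * y = P.p) : ∃ c, Vgr.mk Q = Vgr.mk P + c := by
  -- Compressing to `p x q` and `q y p` keeps the product equal to `p` and makes `y' x'` an
  -- idempotent below `q`.
  have hx' := mul_mem_degree (mul_mem_degree P.mem hx) Q.mem
  have hy' := mul_mem_degree (mul_mem_degree Q.mem hy) P.mem
  set x' := P.p * x * Q.p with hx'_def
  set y' := Q.p * y * P.p with hy'_def
  have hxy : x' * y' = P.p := by
    calc x' * y' = P.p * (x * (Q.p * Q.p) * y) * P.p := by
          simp only [hx'_def, hy'_def, Matrix.mul_assoc]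
      _ = P.p := by rw [Q.idem, h, P.idem, P.idem]
  have hPx : P.p * x' = x' := by
    rw [hx'_def, ← Matrix.mul_assoc, ← Matrix.mul_assoc, P.idem]
  have hxQ : x' * Q.p = x' := by
    rw [hx'_def, Matrix.mul_assoc, Q.idem]
  have hQy : Q.p * y' = y' := by
    rw [hy'_def, ← Matrix.mul_assoc, ← Matrix.mul_assoc, Q.idem]
  set q := y' * x' with hq
  have hqq : q * q = q := by
    rw [hq, Matrix.mul_assoc, ← Matrix.mul_assoc x', hxy, hPx]
  have hQq : Q.p * q = q := by rw [hq, ← Matrix.mul_assoc, hQy]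
  have hqQ : q * Q.p = q := by rw [hq, Matrix.mul_assoc, hxQ]
  have hqmem : ∀ i j, q i j ∈ 𝒜 (Q.d j - Q.d i) := mul_mem_degree hy' hx'
  let R : GradedIdempotent 𝒜 := ⟨Q.ι, Q.d, q, hqmem, hqq⟩
  let R' : GradedIdempotent 𝒜 := ⟨Q.ι, Q.d, Q.p - q,
    fun i j => sub_mem (Q.mem i j) (hqmem i j), by
      rw [Matrix.sub_mul, Matrix.mul_sub, Matrix.mul_sub, Q.idem, hQq, hqQ, hqq, sub_self, sub_zero]⟩
  have hPR : Vgr.mk P = Vgr.mk R := Quotient.sound ⟨x', y', hx', hy', hxy, rfl⟩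
  -- The complement is `q - y' x'`; the two orthogonal idempotents are joined by a row and a column
  -- of blocks.
  refine ⟨Vgr.mk R', ?_⟩
  rw [hPR]
  refine Quotient.sound ⟨Matrix.fromCols q (Q.p - q), Matrix.fromRows q (Q.p - q), ?_, ?_, ?_, ?_⟩
  · rintro i (j | j)
    · exact hqmem i j
    · exact sub_mem (Q.mem i j) (hqmem i j)
  · rintro (j | j) i
    · exact hqmem j i
    · exact sub_mem (Q.mem j i) (hqmem j i)
  · refine (Matrix.nonUnital_fromCols_mul_fromRows _ _ _ _).trans ?_
    rw [hqq, R'.idem, add_sub_cancel]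
  · refine (Matrix.nonUnital_fromRows_mul_fromCols _ _ _ _).trans ?_
    rw [Matrix.mul_sub, Matrix.sub_mul, hqq, hqQ, hQq, R'.idem, sub_self]
    rfl

/-- If the entries of `p` are sums of products `x q y` of the right degrees, for entries `q` of
matrices with classes in `N`, then the class of `p` is in `N`. -/
theorem mk_mem_of_entries (N : OrderIdeal (Multiplicative ℤ) (Vgr 𝒜)) (P : GradedIdempotent 𝒜)
    (h : ∀ i j, P.p i j ∈ AddSubgroup.closure {z : A | ∃ (Q : GradedIdempotent 𝒜) (k l : Q.ι)
      (x y : A), Vgr.mk Q ∈ N ∧ x ∈ 𝒜 (Q.d k - P.d i) ∧ y ∈ 𝒜 (P.d j - Q.d l) ∧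
        z = x * Q.p k l * y}) : Vgr.mk P ∈ N := by
  classical
  -- The matrices that factor through some class in `N` form a group, since the direct sum of the
  -- middle idempotents factors a sum. It is then enough to treat matrices with a single nonzero
  -- entry.
  let S : AddSubgroup (Matrix P.ι P.ι A) :=
    { carrier := {M | ∃ (Q : GradedIdempotent 𝒜) (x : Matrix P.ι Q.ι A) (y : Matrix Q.ι P.ι A),
        Vgr.mk Q ∈ N ∧ (∀ i j, x i j ∈ 𝒜 (Q.d j - P.d i)) ∧ (∀ j i, y j i ∈ 𝒜 (P.d i - Q.d j)) ∧
          x * Q.p * y = M}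
      zero_mem' := ⟨zero 𝒜, 0, 0, N.zero_mem, fun _ _ => zero_mem _, fun _ _ => zero_mem _,
        Matrix.mul_zero _⟩
      add_mem' := by
        rintro _ _ ⟨Q, x, y, hQ, hx, hy, rfl⟩ ⟨Q', x', y', hQ', hx', hy', rfl⟩
        refine ⟨Q.directSum Q', Matrix.fromCols x x', Matrix.fromRows y y', N.add_mem hQ hQ',
          ?_, ?_, ?_⟩
        · rintro i (j | j)
          · exact hx i j
          · exact hx' i j
        · rintro (j | j) i
          · exact hy j i
          · exact hy' j i
        · refine (congrArg (· * Matrix.fromRows y y')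
            (Matrix.nonUnital_fromCols_mul_fromBlocks_diagonal x x' Q.p Q'.p)).trans ?_
          exact Matrix.nonUnital_fromCols_mul_fromRows _ _ _ _
      neg_mem' := by
        rintro _ ⟨Q, x, y, hQ, hx, hy, rfl⟩
        exact ⟨Q, -x, y, hQ, fun i j => neg_mem (hx i j), hy, by simp⟩ }
  have hsingle : ∀ i j, Matrix.single i j (P.p i j) ∈ S := by
    intro i j
    refine (AddSubgroup.closure_le (S.comap (Matrix.singleAddMonoidHom i j))).2 ?_ (h i j)
    rintro _ ⟨Q, k, l, x, y, hQ, hx, hy, rfl⟩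
    refine ⟨Q, Matrix.single i k x, Matrix.single l j y, hQ, ?_, ?_, ?_⟩
    · intro i' k'
      rw [Matrix.single_apply]
      split_ifs with h'
      · rw [← h'.1, ← h'.2]
        exact hx
      · exact zero_mem _
    · intro l' j'
      rw [Matrix.single_apply]
      split_ifs with h'
      · rw [← h'.1, ← h'.2]
        exact hy
      · exact zero_mem _
    · exact Matrix.single_mul_mul_single _ _ _ _ _ _ _
  have hP : P.p ∈ S := by
    rw [Matrix.matrix_eq_sum_single P.p]
    exact sum_mem fun i _ => sum_mem fun j _ => hsingle i j
  obtain ⟨Q, x, y, hQ, hx, hy, h'⟩ := hP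
  obtain ⟨c, hc⟩ := exists_mk_eq_add hx hy h'
  exact N.mem_of_add_mem (hc ▸ hQ)

end GradedIdempotent

/-! ### The order ideal attached to an ideal of the ring -/

namespace Vgr

open GradedIdempotent

variable {A : Type u} [NonUnitalRing A] {𝒜 : ℤ → AddSubgroup A} [SetLike.GradedMul 𝒜]

/-- The classes of the idempotent matrices with entries in a given ideal. -/
def ofIdeal (J : TwoSidedIdeal A) : OrderIdeal (Multiplicative ℤ) (Vgr 𝒜) where
  carrier := {c | ∃ P : GradedIdempotent 𝒜, mk P = c ∧ ∀ i j, P.p i j ∈ J}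
  zero_mem' := ⟨zero 𝒜, rfl, fun i => i.elim⟩
  add_mem' := by
    rintro _ _ ⟨P, rfl, hP⟩ ⟨Q, rfl, hQ⟩
    refine ⟨P.directSum Q, rfl, ?_⟩
    rintro (i | i) (j | j)
    · exact hP i j
    · exact zero_mem _
    · exact zero_mem _
    · exact hQ i j
  smul_mem' := by
    rintro g _ ⟨P, rfl, hP⟩
    exact ⟨P.shift g.toAdd, rfl, hP⟩
  hereditary' := by
    rintro ⟨P⟩ b ⟨⟨Q⟩, rfl⟩ ⟨R, hR, hR'⟩
    have h : Equivalent R (P.directSum Q) := Quotient.exact hR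
    exact ⟨P, rfl, fun i j => h.entries_mem hR' (Sum.inl i) (Sum.inl j)⟩

theorem mk_mem_ofIdeal {J : TwoSidedIdeal A} {P : GradedIdempotent 𝒜} :
    mk P ∈ (ofIdeal J : OrderIdeal (Multiplicative ℤ) (Vgr 𝒜)) ↔ ∀ i j, P.p i j ∈ J := by
  constructor
  · rintro ⟨Q, hQ, h⟩
    have h' : Equivalent Q P := Quotient.exact hQ
    exact h'.entries_mem h
  · exact fun h => ⟨P, rfl, h⟩

end Vgr

namespace DirGraph

variable {k : Type w} [Field k] {V : Type u} {E : Type v} {G : DirGraph V E}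

/-! ### Graded ideals and vertices -/

/-- A homogeneous element of an ideal lies in the ideal that is generated by any set which contains
the vertices of that ideal. -/
theorem mem_span_of_homogeneous (hG : G.IsRowFinite) {n : ℤ} {a : Leavitt k G}
    (ha : a ∈ leavittGrading k G n) {H : Set V}
    (h : ∀ x y u, x * a * y = leavittVertex k G u → u ∈ H) :
    a ∈ TwoSidedIdeal.span (leavittVertex k G '' H) := by
  set J := TwoSidedIdeal.span (leavittVertex k G '' H)
  have hle : reductions k G n a ≤ AddSubgroup.ofClass J := by
    refine (AddSubgroup.closure_le _).2 ?_
    rintro _ ⟨u, i, x, y, x', y', -, -, -, -, hu, rfl⟩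
    exact J.mul_mem_right _ _ (J.mul_mem_left _ _
      (TwoSidedIdeal.subset_span ⟨u, h x' y' u hu, rfl⟩))
  exact hle (mem_reductions hG ha)

/-- Each vertex recovered from `a` lies in both ideals, hence by separation in `H₁ ∩ H₂ ⊆ H`. -/
theorem mem_span_inter (hG : G.IsRowFinite) {H₁ H₂ H : G.HerSat}
    (h : ∀ x, x ∈ H₁.1 → x ∈ H₂.1 → x ∈ H.1) {n : ℤ} {a : Leavitt k G}
    (ha : a ∈ leavittGrading k G n)
    (h₁ : a ∈ TwoSidedIdeal.span (leavittVertex k G '' H₁.1))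
    (h₂ : a ∈ TwoSidedIdeal.span (leavittVertex k G '' H₂.1)) :
    a ∈ TwoSidedIdeal.span (leavittVertex k G '' H.1) := by
  refine mem_span_of_homogeneous hG ha fun x y u hu => h u ?_ ?_
  · refine mem_of_vertex_mem_span k hG H₁.2.1 H₁.2.2 ?_
    rw [← hu]
    exact TwoSidedIdeal.mul_mem_right _ _ _ (TwoSidedIdeal.mul_mem_left _ _ _ h₁)
  · refine mem_of_vertex_mem_span k hG H₂.2.1 H₂.2.2 ?_
    rw [← hu]
    exact TwoSidedIdeal.mul_mem_right _ _ _ (TwoSidedIdeal.mul_mem_left _ _ _ h₂)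

/-- Because `r(e) = e* s(e) e`. -/
theorem isHereditary_of_ideal (I : TwoSidedIdeal (Leavitt k G)) :
    G.IsHereditary {x | leavittVertex k G x ∈ I} := by
  intro e he
  change leavittVertex k G (G.rng e) ∈ I
  rw [← ghost_mul_edge_self, ← src_mul_edge, ← mul_assoc]
  exact I.mul_mem_right _ _ (I.mul_mem_left _ _ he)

/-- Because `x = ∑ e r(e) e*`. -/
theorem isSaturated_of_ideal (hG : G.IsRowFinite) (I : TwoSidedIdeal (Leavitt k G)) :
    G.IsSaturated {x | leavittVertex k G x ∈ I} := by
  intro x hx h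
  change leavittVertex k G x ∈ I
  rw [vertex_eq_sum G hx (hG x)]
  refine sum_mem fun e he => ?_
  rw [← edge_mul_rng]
  exact I.mul_mem_right _ _ (I.mul_mem_left _ _ (h e ((hG x).mem_toFinset.1 he)))

theorem mul_mem_of_homogeneous {A : Type*} [NonUnitalRing A] {𝒜 : ℤ → AddSubgroup A}
    [SetLike.GradedMul 𝒜] (h𝒜 : AddSubgroup.closure {a : A | ∃ n, a ∈ 𝒜 n} = ⊤)
    (J : TwoSidedIdeal A) {a : A}
    (ha : a ∈ AddSubgroup.closure {b : A | b ∈ J ∧ ∃ n : ℤ, b ∈ 𝒜 n}) (c : A) :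
    c * a ∈ AddSubgroup.closure {b : A | b ∈ J ∧ ∃ n : ℤ, b ∈ 𝒜 n} ∧
    a * c ∈ AddSubgroup.closure {b : A | b ∈ J ∧ ∃ n : ℤ, b ∈ 𝒜 n} := by
  have hc : c ∈ AddSubgroup.closure {a : A | ∃ n, a ∈ 𝒜 n} := h𝒜 ▸ AddSubgroup.mem_top c
  constructor
  · refine mul_left_mem_closure ha ?_
    rintro b ⟨hb, n, hn⟩
    refine mul_right_mem_closure hc ?_
    rintro d ⟨m, hm⟩
    exact AddSubgroup.subset_closure ⟨J.mul_mem_left _ _ hb, _, SetLike.mul_mem_graded hm hn⟩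
  · refine mul_right_mem_closure ha ?_
    rintro b ⟨hb, n, hn⟩
    refine mul_left_mem_closure hc ?_
    rintro d ⟨m, hm⟩
    exact AddSubgroup.subset_closure ⟨J.mul_mem_right _ _ hb, _, SetLike.mul_mem_graded hn hm⟩

theorem span_vertices_graded (H : Set V) (a : Leavitt k G)
    (ha : a ∈ TwoSidedIdeal.span (leavittVertex k G '' H)) :
    a ∈ AddSubgroup.closure {b : Leavitt k G |
      b ∈ TwoSidedIdeal.span (leavittVertex k G '' H) ∧ ∃ n : ℤ, b ∈ leavittGrading k G n} := by
  set J := TwoSidedIdeal.span (leavittVertex k G '' H) with hJ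
  have hmul := fun a ha c => mul_mem_of_homogeneous (𝒜 := leavittGrading k G)
    (closure_homogeneous_eq_top G) J (a := a) ha c
  -- The span of the homogeneous elements of `J` is itself an ideal, as `L(E)` is spanned by
  -- homogeneous elements, and it contains the generators of `J`, which have degree `0`.
  let T : TwoSidedIdeal (Leavitt k G) := TwoSidedIdeal.mk'
    (AddSubgroup.closure {b : Leavitt k G | b ∈ J ∧ ∃ n : ℤ, b ∈ leavittGrading k G n})
    (zero_mem _) (fun h1 h2 => add_mem h1 h2) (fun h => neg_mem h)
    (fun {c a} ha => (hmul a ha c).1) (fun {a c} ha => (hmul a ha c).2)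
  have hle : J ≤ T := by
    refine TwoSidedIdeal.span_le.2 ?_
    rintro _ ⟨x, hx, rfl⟩
    exact (TwoSidedIdeal.mem_mk' _ _ _ _ _ _ _).2 (AddSubgroup.subset_closure
      ⟨TwoSidedIdeal.subset_span ⟨x, hx, rfl⟩, 0, leavittVertex_mem k G x⟩)
  exact (TwoSidedIdeal.mem_mk' _ _ _ _ _ _ _).1 (hle ha)

variable (k) in
/-- Hereditary saturated sets correspond to graded ideals. -/
noncomputable def gradedIdealIso (hG : G.IsRowFinite) :
    G.HerSat ≃o GradedIdeal (leavittGrading k G) :=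
  Equiv.toOrderIso
    { toFun := fun H => ⟨TwoSidedIdeal.span (leavittVertex k G '' H.1), span_vertices_graded H.1⟩
      invFun := fun I => ⟨{x | leavittVertex k G x ∈ I.1}, isHereditary_of_ideal I.1,
        isSaturated_of_ideal hG I.1⟩
      left_inv := fun H => Subtype.ext (Set.ext fun _ =>
        ⟨fun hx => mem_of_vertex_mem_span k hG H.2.1 H.2.2 hx,
          fun hx => TwoSidedIdeal.subset_span ⟨_, hx, rfl⟩⟩)
      right_inv := fun I => Subtype.ext (le_antisymm
        (TwoSidedIdeal.span_le.2 (by rintro _ ⟨x, hx, rfl⟩; exact hx))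
        (fun a ha => by
          have hle : AddSubgroup.closure {b | b ∈ I.1 ∧ ∃ n : ℤ, b ∈ leavittGrading k G n} ≤
              AddSubgroup.ofClass (TwoSidedIdeal.span
                (leavittVertex k G '' {x | leavittVertex k G x ∈ I.1})) := by
            refine (AddSubgroup.closure_le _).2 ?_
            rintro b ⟨hb, n, hn⟩
            refine mem_span_of_homogeneous hG hn fun x y u hu => ?_
            change leavittVertex k G u ∈ I.1
            rw [← hu]
            exact I.1.mul_mem_right _ _ (I.1.mul_mem_left _ _ hb)
          exact hle (I.2 a ha))) }
    (fun _ _ h => TwoSidedIdeal.span_mono (Set.image_mono h))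
    (fun _ _ h _ hx => h hx)

/-! ### Order ideals and vertices -/

theorem vertexClass_mem_of_zero {N : OrderIdeal (Multiplicative ℤ) (Vgr (leavittGrading k G))}
    {x : V} (h : vertexClass k G x 0 ∈ N) (n : ℤ) : vertexClass k G x n ∈ N := by
  have h' : vertexClass k G x (0 + n) ∈ N := N.smul_mem (Multiplicative.ofAdd n) h
  rwa [zero_add] at h'

/-- The factorization `r(e) = e* s(e) e` makes `L(E) r(e)` a summand of `L(E) s(e)` shifted by `-1`,
the shift for which `e*` and `e` are matrices of degree zero. -/
theorem isHereditary_of_orderIdeal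
    (N : OrderIdeal (Multiplicative ℤ) (Vgr (leavittGrading k G))) :
    G.IsHereditary {x | vertexClass k G x 0 ∈ N} := by
  intro e he
  refine GradedIdempotent.mk_mem_of_entries N _ fun _ _ => AddSubgroup.subset_closure
    ⟨GradedIdempotent.single (leavittVertex k G (G.src e)) (leavittVertex_mem k G _)
      (leavittVertex_mul_self k G _) (-1), (), (), leavittGhost k G e, leavittEdge k G e,
      vertexClass_mem_of_zero he (-1), leavittGhost_mem G e, leavittEdge_mem G e, ?_⟩
  change leavittVertex k G (G.rng e) =
    leavittGhost k G e * leavittVertex k G (G.src e) * leavittEdge k G e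
  rw [ghost_mul_src, ghost_mul_edge_self]

/-- The factorization is `x = ∑ e r(e) e*`, with the opposite shift `1`. -/
theorem isSaturated_of_orderIdeal (hG : G.IsRowFinite)
    (N : OrderIdeal (Multiplicative ℤ) (Vgr (leavittGrading k G))) :
    G.IsSaturated {x | vertexClass k G x 0 ∈ N} := by
  intro x hx h
  refine GradedIdempotent.mk_mem_of_entries N _ fun _ _ => ?_
  refine Set.mem_of_eq_of_mem (vertex_eq_sum G hx (hG x)) ?_
  refine sum_mem fun e he => AddSubgroup.subset_closure
    ⟨GradedIdempotent.single (leavittVertex k G (G.rng e)) (leavittVertex_mem k G _)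
      (leavittVertex_mul_self k G _) 1, (), (), leavittEdge k G e, leavittGhost k G e,
      vertexClass_mem_of_zero (h e ((hG x).mem_toFinset.1 he)) 1, leavittEdge_mem G e,
      leavittGhost_mem G e, ?_⟩
  change _ = leavittEdge k G e * leavittVertex k G (G.rng e) * leavittGhost k G e
  rw [edge_mul_rng]

theorem mk_mem_of_vertexClass_mem (hG : G.IsRowFinite)
    (N : OrderIdeal (Multiplicative ℤ) (Vgr (leavittGrading k G))) {J : TwoSidedIdeal (Leavitt k G)}
    (hJ : ∀ x, leavittVertex k G x ∈ J → vertexClass k G x 0 ∈ N)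
    {P : GradedIdempotent (leavittGrading k G)} (hP : ∀ i j, P.p i j ∈ J) : Vgr.mk P ∈ N := by
  refine GradedIdempotent.mk_mem_of_entries N P fun i j => ?_
  refine AddSubgroup.closure_mono ?_ (mem_reductions hG (P.mem i j))
  rintro _ ⟨u, n, x, y, x', y', hx, hy, -, -, hu, rfl⟩
  have huJ : leavittVertex k G u ∈ J := by
    rw [← hu]
    exact J.mul_mem_right _ _ (J.mul_mem_left _ _ (hP i j))
  -- With `x` of degree `n` and row shift `P.d i`, the vertex must sit in shift `n + P.d i`.
  refine ⟨GradedIdempotent.single (leavittVertex k G u) (leavittVertex_mem k G _)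
    (leavittVertex_mul_self k G _) (n + P.d i), (), (), x, y, vertexClass_mem_of_zero (hJ u huJ) _,
    ?_, ?_, rfl⟩
  · change x ∈ leavittGrading k G (n + P.d i - P.d i)
    rwa [add_sub_cancel_right]
  · change y ∈ leavittGrading k G (P.d j - (n + P.d i))
    rwa [add_comm, ← sub_sub]

/-- Read backwards, reduction gives `u = x' p_{ij} y'`, so `L(E) u` is a summand of a shift of the
module of `P`. The shift `-n - P.d i` puts row `i` in shift `-n`, the degree of `x'`. -/
theorem entries_mem_of_mk_mem (hG : G.IsRowFinite)
    {N : OrderIdeal (Multiplicative ℤ) (Vgr (leavittGrading k G))}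
    {P : GradedIdempotent (leavittGrading k G)} (hP : Vgr.mk P ∈ N) (i j : P.ι) :
    P.p i j ∈ TwoSidedIdeal.span (leavittVertex k G '' {x | vertexClass k G x 0 ∈ N}) := by
  set J := TwoSidedIdeal.span (leavittVertex k G '' {x | vertexClass k G x 0 ∈ N})
  have hle : reductions k G (P.d j - P.d i) (P.p i j) ≤ AddSubgroup.ofClass J := by
    refine (AddSubgroup.closure_le _).2 ?_
    rintro _ ⟨u, n, x, y, x', y', -, -, hx, hy, hu, rfl⟩
    refine J.mul_mem_right _ _ (J.mul_mem_left _ _ (TwoSidedIdeal.subset_span ⟨u, ?_, rfl⟩))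
    refine GradedIdempotent.mk_mem_of_entries N _ fun _ _ => AddSubgroup.subset_closure
      ⟨P.shift (-n - P.d i), i, j, x', y', N.smul_mem (Multiplicative.ofAdd (-n - P.d i)) hP,
        ?_, ?_, hu.symm⟩
    · change x' ∈ leavittGrading k G (P.d i + (-n - P.d i) - 0)
      rwa [sub_zero, add_sub_cancel]
    · change y' ∈ leavittGrading k G (0 - (P.d j + (-n - P.d i)))
      rwa [show 0 - (P.d j + (-n - P.d i)) = n - (P.d j - P.d i) by ring]
  exact hle (mem_reductions hG (P.mem i j))

theorem vertexClass_mem_ofIdeal {J : TwoSidedIdeal (Leavitt k G)} {x : V} {n : ℤ} :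
    vertexClass k G x n ∈ (Vgr.ofIdeal J : OrderIdeal (Multiplicative ℤ) (Vgr (leavittGrading k G)))
      ↔ leavittVertex k G x ∈ J :=
  Vgr.mk_mem_ofIdeal.trans ⟨fun h => h () (), fun h _ _ => h⟩

variable (k) in
/-- Hereditary saturated sets correspond to order ideals of `V^gr`. -/
noncomputable def orderIdealIso (hG : G.IsRowFinite) :
    G.HerSat ≃o OrderIdeal (Multiplicative ℤ) (Vgr (leavittGrading k G)) :=
  Equiv.toOrderIso
    { toFun := fun H => Vgr.ofIdeal (TwoSidedIdeal.span (leavittVertex k G '' H.1))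
      invFun := fun N => ⟨{x | vertexClass k G x 0 ∈ N}, isHereditary_of_orderIdeal N,
        isSaturated_of_orderIdeal hG N⟩
      left_inv := fun H => Subtype.ext (Set.ext fun _ => vertexClass_mem_ofIdeal.trans
        ⟨fun hx => mem_of_vertex_mem_span k hG H.2.1 H.2.2 hx,
          fun hx => TwoSidedIdeal.subset_span ⟨_, hx, rfl⟩⟩)
      right_inv := fun N => SetLike.ext (by
        rintro ⟨P⟩
        refine Vgr.mk_mem_ofIdeal.trans ⟨fun h => ?_, fun h => entries_mem_of_mk_mem hG h⟩
        exact mk_mem_of_vertexClass_mem hG N (fun x hx => mem_of_vertex_mem_span k hG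
          (isHereditary_of_orderIdeal N) (isSaturated_of_orderIdeal hG N) hx) h) }
    (by
      rintro H K h ⟨P⟩ hP
      exact Vgr.mk_mem_ofIdeal.2 fun i j =>
        TwoSidedIdeal.span_mono (Set.image_mono h) (Vgr.mk_mem_ofIdeal.1 hP i j))
    (fun _ _ h _ hx => h hx)

theorem isLeast_orderIdealIso (hG : G.IsRowFinite) (H : G.HerSat) :
    IsLeast {N : OrderIdeal (Multiplicative ℤ) (Vgr (leavittGrading k G)) |
      ∀ x ∈ H.1, ∀ n : ℤ, vertexClass k G x n ∈ N} (orderIdealIso k hG H) := by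
  refine ⟨fun x hx n => vertexClass_mem_ofIdeal.2 (TwoSidedIdeal.subset_span ⟨x, hx, rfl⟩), ?_⟩
  rintro N hN ⟨P⟩ hP
  exact mk_mem_of_vertexClass_mem hG N
    (fun x hx => hN x (mem_of_vertex_mem_span k hG H.2.1 H.2.2 hx) 0) (Vgr.mk_mem_ofIdeal.1 hP)

/-! ### Primes -/

/-- The hereditary saturated sets that correspond to primes. -/
def HerSat.IsPrime (H : G.HerSat) : Prop :=
  ∀ H₁ H₂ : G.HerSat, (∀ x, x ∈ H₁.1 → x ∈ H₂.1 → x ∈ H.1) → H₁ ≤ H ∨ H₂ ≤ H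

theorem vertex_mem_gradedIdealIso (hG : G.IsRowFinite) {H : G.HerSat} {x : V} :
    leavittVertex k G x ∈ (gradedIdealIso k hG H).1 ↔ x ∈ H.1 :=
  ⟨fun hx => mem_of_vertex_mem_span k hG H.2.1 H.2.2 hx,
    fun hx => TwoSidedIdeal.subset_span ⟨_, hx, rfl⟩⟩

/-- Gradedness allows both factors to be taken homogeneous; their product is then homogeneous and
lies in both ideals, so `mem_span_inter` applies. -/
theorem mul_mem_gradedIdealIso (hG : G.IsRowFinite) {H₁ H₂ H : G.HerSat}
    (h : ∀ x, x ∈ H₁.1 → x ∈ H₂.1 → x ∈ H.1) {a b : Leavitt k G}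
    (ha : a ∈ (gradedIdealIso k hG H₁).1) (hb : b ∈ (gradedIdealIso k hG H₂).1) :
    a * b ∈ (gradedIdealIso k hG H).1 := by
  let T := AddSubgroup.ofClass (gradedIdealIso k hG H).1
  change a * b ∈ T
  refine mul_right_mem_closure ((gradedIdealIso k hG H₁).2 a ha) ?_
  rintro c ⟨hc, m, hm⟩
  refine mul_left_mem_closure ((gradedIdealIso k hG H₂).2 b hb) ?_
  rintro d ⟨hd, n, hn⟩
  exact mem_span_inter hG h (SetLike.mul_mem_graded hm hn)
    (TwoSidedIdeal.mul_mem_right _ _ _ hc) (TwoSidedIdeal.mul_mem_left _ _ _ hd)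

theorem isGradedPrime_iff (hG : G.IsRowFinite) (H : G.HerSat) :
    (gradedIdealIso k hG H).IsGradedPrime ↔ H.IsPrime := by
  constructor
  · intro hP H₁ H₂ h
    simpa only [OrderIso.le_iff_le] using
      hP (gradedIdealIso k hG H₁) (gradedIdealIso k hG H₂)
        fun a ha b hb => mul_mem_gradedIdealIso hG h ha hb
  · intro hH I J hIJ
    obtain ⟨H₁, rfl⟩ := (gradedIdealIso k hG).surjective I
    obtain ⟨H₂, rfl⟩ := (gradedIdealIso k hG).surjective J
    simp only [OrderIso.le_iff_le]
    refine hH H₁ H₂ fun x h₁ h₂ => (vertex_mem_gradedIdealIso (k := k) hG).1 ?_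
    rw [← leavittVertex_mul_self]
    exact hIJ _ ((vertex_mem_gradedIdealIso hG).2 h₁) _ ((vertex_mem_gradedIdealIso hG).2 h₂)

theorem vertexClass_mem_orderIdealIso (hG : G.IsRowFinite) {H : G.HerSat} {x : V} {n : ℤ} :
    vertexClass k G x n ∈ orderIdealIso k hG H ↔ x ∈ H.1 :=
  vertexClass_mem_ofIdeal.trans (vertex_mem_gradedIdealIso hG)

theorem isPrime_iff (hG : G.IsRowFinite) (H : G.HerSat) :
    (orderIdealIso k hG H).IsPrime ↔ H.IsPrime := by
  constructor
  · intro hN H₁ H₂ h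
    have h' := hN (orderIdealIso k hG H₁) (orderIdealIso k hG H₂) (by
      rintro ⟨P⟩ ⟨h₁, h₂⟩
      exact Vgr.mk_mem_ofIdeal.2 fun i j => mem_span_inter hG h (P.mem i j)
        (Vgr.mk_mem_ofIdeal.1 h₁ i j) (Vgr.mk_mem_ofIdeal.1 h₂ i j))
    simpa only [SetLike.coe_subset_coe, OrderIso.le_iff_le] using h'
  · intro hH N₁ N₂ hN
    obtain ⟨H₁, rfl⟩ := (orderIdealIso k hG).surjective N₁
    obtain ⟨H₂, rfl⟩ := (orderIdealIso k hG).surjective N₂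
    simp only [SetLike.coe_subset_coe, OrderIso.le_iff_le]
    exact hH H₁ H₂ fun x h₁ h₂ => (vertexClass_mem_orderIdealIso (k := k) (n := 0) hG).1
      (hN ⟨(vertexClass_mem_orderIdealIso hG).2 h₁, (vertexClass_mem_orderIdealIso hG).2 h₂⟩)

variable (k) in
/-- Graded prime ideals correspond to prime order ideals of `V^gr`. -/
noncomputable def gradedPrimeIso (hG : G.IsRowFinite) :
    {P : GradedIdeal (leavittGrading k G) // P.IsGradedPrime} ≃o
      {N : OrderIdeal (Multiplicative ℤ) (Vgr (leavittGrading k G)) // N.IsPrime} where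
  toEquiv := ((gradedIdealIso k hG).symm.trans (orderIdealIso k hG)).toEquiv.subtypeEquiv (by
    intro P
    obtain ⟨H, rfl⟩ := (gradedIdealIso k hG).surjective P
    refine (isGradedPrime_iff hG H).trans ((isPrime_iff (k := k) hG H).symm.trans ?_)
    simp)
  map_rel_iff' := ((gradedIdealIso k hG).symm.trans (orderIdealIso k hG)).map_rel_iff

/-- Joins of graded ideals define the lattice, so its greatest element must be compared with the
whole ring; this ring is a graded ideal because homogeneous elements span it. -/
theorem val_eq_top_iff (P : GradedIdeal (leavittGrading k G)) : P.1 = ⊤ ↔ P = ⊤ := by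
  constructor
  · intro h
    refine top_unique ?_
    change (⊤ : GradedIdeal (leavittGrading k G)).1 ≤ P.1
    rw [h]
    exact le_top
  · rintro rfl
    have h : ∀ a ∈ (⊤ : TwoSidedIdeal (Leavitt k G)), a ∈ AddSubgroup.closure
        {b : Leavitt k G | b ∈ (⊤ : TwoSidedIdeal (Leavitt k G)) ∧
          ∃ n : ℤ, b ∈ leavittGrading k G n} := by
      intro a _
      have ha : a ∈ AddSubgroup.closure {a : Leavitt k G | ∃ n, a ∈ leavittGrading k G n} := by
        rw [closure_homogeneous_eq_top]
        trivial
      refine AddSubgroup.closure_mono ?_ ha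
      exact fun b hb => ⟨trivial, hb⟩
    let T : GradedIdeal (leavittGrading k G) := ⟨⊤, h⟩
    exact top_unique (le_top : T ≤ ⊤)

end DirGraph

theorem OrderIdeal.coe_eq_univ_iff {Γ : Type v} {M : Type u} [Group Γ] [AddCommMonoid M]
    [DistribMulAction Γ M] (N : OrderIdeal Γ M) : (N : Set M) = Set.univ ↔ N = ⊤ := by
  -- The greatest order ideal is the infimum of the empty family, so membership is vacuous.
  have h : ((⊤ : OrderIdeal Γ M) : Set M) = Set.univ :=
    Set.eq_univ_of_forall fun _ _ hN => hN.elim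
  rw [← h, SetLike.coe_set_eq]

theorem mainTheorem5 {k : Type w} [Field k] {V : Type u} {E : Type v} (G : DirGraph V E)
    (hG : G.IsRowFinite) :
    ∃ (Ψ : G.HerSat ≃o GradedIdeal (G.leavittGrading k))
      (Φ : G.HerSat ≃o OrderIdeal (Multiplicative ℤ) (Vgr (G.leavittGrading k)))
      (Θ : {P : GradedIdeal (G.leavittGrading k) // P.IsGradedPrime} ≃o
        {N : OrderIdeal (Multiplicative ℤ) (Vgr (G.leavittGrading k)) // N.IsPrime}),
      (∀ H : G.HerSat, (Ψ H).1 = TwoSidedIdeal.span (G.leavittVertex k '' H.1)) ∧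
      (∀ H : G.HerSat,
        IsLeast {N : OrderIdeal (Multiplicative ℤ) (Vgr (G.leavittGrading k)) |
          ∀ x ∈ H.1, ∀ n : ℤ, G.vertexClass k x n ∈ N} (Φ H)) ∧
      (∀ P, (Θ P).1 = Φ (Ψ.symm P.1)) ∧
      (∀ P, P.1.1 = ⊤ ↔ ((Θ P).1 : Set (Vgr (G.leavittGrading k))) = Set.univ) := by
  refine ⟨DirGraph.gradedIdealIso k hG, DirGraph.orderIdealIso k hG, DirGraph.gradedPrimeIso k hG,
    fun _ => rfl, DirGraph.isLeast_orderIdealIso hG, fun _ => rfl, fun P => ?_⟩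
  rw [DirGraph.val_eq_top_iff, OrderIdeal.coe_eq_univ_iff]
  exact (map_eq_top_iff (f := (DirGraph.gradedIdealIso k hG).symm.trans
    (DirGraph.orderIdealIso k hG)) (a := P.1)).symm
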